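/- **Setting.** Let $K\ge 2$ be fixed. Consider a sequence of problems indexed by $m\in\mathbb N$, with dimension $p=p(m)$ and total sample size $n=n(m)$. For each $m$ let $F$ (depending on $m$) be a probability distribution on $\mathbb R^p$, and let $X_1,X_2,\dots$ be i.i.d. from $F$. With $\|\cdot\|$ the Euclidean norm, put $$d(x,y)=\|x-y\|-\mathbb E\|x-X_1\|-\mathbb E\|X_1-y\|+\mathbb E\|X_1-X_2\| .$$ Assume that for each $m$ - (C1) $\mathbb E\|X_1\|^4<\infty$, and $\mathbb E\,d^2(X_1,X_2)>0$; and that, as $m\to\infty$, - (C2) $\dfrac{\mathbb E\, d^4(X_1,X_2)}{n\,(\mathbb E\, d^2(X_1,X_2))^2}\to 0$; - (C3) $\dfrac{\mathbb E\,[d(X_1,X_3)d(X_2,X_3)d(X_1,X_4)d(X_2,X_4)]}{(\mathbb E\, d^2(X_1,X_2))^2}\to 0$. **Statistics.** For data $X_1,\dots,X_n\in\mathbb R^p$ with labels $Y_1,\dots,Y_n\in\{1,\dots,K\}$, let $n_k=\#\{i:Y_i=k\}$, $\hat p_k=n_k/n$, $$\hat\Delta=\binom n2^{-1}\sum_{i<j}\|X_i-X_j\|,\qquad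 \hat\Delta_k=\binom{n_k}2^{-1}\sum_{i<j,\;Y_i=Y_j=k}\|X_i-X_j\|,$$ $$\mathrm{gCov}_n=\hat\Delta-\sum_{k=1}^K\hat p_k\hat\Delta_k,\qquad \mathrm{gCor}_n=\mathrm{gCov}_n/\hat\Delta,$$ $$\hat\sigma_0^2=\Big(\sum_{k=1}^K\hat p_k^2\binom{n_k}2^{-1}-\binom n2^{-1}\Big)V_n^2,\qquad V_n^2=\frac1{n(n-3)}\sum_{k\ne l}A_{k,l}^2,$$ $$A_{k,l}=\|X_k-X_l\|-\frac1{n-2}\sum_{i=1}^n\|X_i-X_l\|-\frac1{n-2}\sum_{j=1}^n\|X_k-X_j\|+\frac1{(n-1)(n-2)}\sum_{i,j=1}^n\|X_i-X_j\| .$$ **Claim.** Let $p\to\infty$. Then $$\frac{\hat\Delta}{\hat\sigma_0}\,\mathrm{gCor}_n\ \xrightarrow{\;d\;}\ \mathcal N(0,1)$$ under each of the following two sampling schemes, in which the numerical variable $X$ and the label $Y$ are independent. 1. *Random labels.* For each $m$ the data $(X_i,Y_i)$, $1\le i\le n$, are i.i.d. copies of a pair $(X,Y)$, where $X\sim F$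 and $Y$ are independent and $P(Y=k)=p_k>0$ with $p_1,\dots,p_K$ not depending on $m$; and $n\to\infty$ (which is equivalent to $\min_k n_k\to\infty$ in probability). 2. *Fixed class sizes.* For each $m$ the labels are deterministic and all observations $X_1,\dots,X_n$ are i.i.d. from $F$, so that every class has the distribution $F$; and $\min_k n_k\to\infty$ with $\liminf_{m\to\infty} n_k/n>0$ for every $k$. -/

import Mathlib

open MeasureTheory ProbabilityTheory Filter
open scoped Topology

namespace GiniCor

noncomputable section

/-- `ℝ^p` with the Euclidean norm. -/
abbrev Eucl (p : ℕ) : Type := EuclideanSpace ℝ (Fin p)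

/-! ### Population quantities of a distribution `F` on `ℝ^p` -/

/-- The double centered distance
`d(x, y) = ‖x - y‖ - E‖x - X‖ - E‖X - y‖ + E‖X - X'‖`, where `X, X'` are i.i.d. from `F`. -/
def doubleCenteredDist {p : ℕ} (F : Measure (Eucl p)) (x y : Eucl p) : ℝ :=
  ‖x - y‖ - (∫ z, ‖x - z‖ ∂F) - (∫ z, ‖z - y‖ ∂F) + ∫ z, ‖z.1 - z.2‖ ∂(F.prod F)

/-- `E d(X₁, X₂) ^ r` for `X₁, X₂` i.i.d. from `F`. -/
def centeredMoment {p : ℕ} (F : Measure (Eucl p)) (r : ℕ) : ℝ :=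
  ∫ z, doubleCenteredDist F z.1 z.2 ^ r ∂(F.prod F)

/-- `E [d(X₁, X₃) d(X₂, X₃) d(X₁, X₄) d(X₂, X₄)]` for `X₁, X₂, X₃, X₄` i.i.d. from `F`
(they are the coordinates `x 0, x 1, x 2, x 3`). -/
def cyclicMoment {p : ℕ} (F : Measure (Eucl p)) : ℝ :=
  ∫ x : Fin 4 → Eucl p,
    doubleCenteredDist F (x 0) (x 2) * doubleCenteredDist F (x 1) (x 2) *
      doubleCenteredDist F (x 0) (x 3) * doubleCenteredDist F (x 1) (x 3)
    ∂(Measure.pi fun _ => F)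

/-! ### Sample quantities of numerical data `x₁, …, x_n` in `ℝ^p` with labels in `{1, …, K}` -/

/-- The indices of the observations in the class `k`. -/
def classIndices {n K : ℕ} (y : Fin n → Fin K) (k : Fin K) : Finset (Fin n) :=
  Finset.univ.filter fun i => y i = k

/-- The class size `n_k`. -/
def classSize {n K : ℕ} (y : Fin n → Fin K) (k : Fin K) : ℕ :=
  (classIndices y k).card

/-- The U-statistic estimator of the Gini mean difference from the observations with index in `s`:
the mean of `‖x_i - x_j‖` over the pairs `i < j` in `s`. -/
def giniMeanDiff {n p : ℕ} (x : Fin n → Eucl p) (s : Finset (Fin n)) : ℝ :=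
  ((s.card.choose 2 : ℕ) : ℝ)⁻¹ *
    ∑ q ∈ (s ×ˢ s).filter (fun q => q.1 < q.2), ‖x q.1 - x q.2‖

/-- `Δ̂`, from the whole sample. -/
def deltaHat {n p : ℕ} (x : Fin n → Eucl p) : ℝ :=
  giniMeanDiff x Finset.univ

/-- `Δ̂_k`, from the class `k`. -/
def deltaHatClass {n p K : ℕ} (x : Fin n → Eucl p) (y : Fin n → Fin K) (k : Fin K) : ℝ :=
  giniMeanDiff x (classIndices y k)

/-- The class proportion `p̂_k = n_k / n`. -/
def pHat {n K : ℕ} (y : Fin n → Fin K) (k : Fin K) : ℝ :=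
  (classSize y k : ℝ) / (n : ℝ)

/-- The sample Gini covariance. -/
def gCovSample {n p K : ℕ} (x : Fin n → Eucl p) (y : Fin n → Fin K) : ℝ :=
  deltaHat x - ∑ k, pHat y k * deltaHatClass x y k

/-- The sample Gini correlation. -/
def gCorSample {n p K : ℕ} (x : Fin n → Eucl p) (y : Fin n → Fin K) : ℝ :=
  gCovSample x y / deltaHat x

/-- The centered sample distance `A_{k,l}`. -/
def sampleCenteredDist {n p : ℕ} (x : Fin n → Eucl p) (k l : Fin n) : ℝ :=
  ‖x k - x l‖ - 1 / ((n : ℝ) - 2) * ∑ i, ‖x i - x l‖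
    - 1 / ((n : ℝ) - 2) * ∑ j, ‖x k - x j‖
    + 1 / (((n : ℝ) - 1) * ((n : ℝ) - 2)) * ∑ i, ∑ j, ‖x i - x j‖

/-- The bias-corrected estimator `V_n²` of the squared distance variance. -/
def distVarHat {n p : ℕ} (x : Fin n → Eucl p) : ℝ :=
  1 / ((n : ℝ) * ((n : ℝ) - 3)) *
    ∑ q ∈ (Finset.univ : Finset (Fin n × Fin n)).filter (fun q => q.1 ≠ q.2),
      sampleCenteredDist x q.1 q.2 ^ 2

/-- `σ̂₀² = (∑ₖ p̂ₖ² C(nₖ, 2)⁻¹ - C(n, 2)⁻¹) V_n²`. -/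
def sigmaHatSq {n p K : ℕ} (x : Fin n → Eucl p) (y : Fin n → Fin K) : ℝ :=
  ((∑ k, pHat y k ^ 2 * (((classSize y k).choose 2 : ℕ) : ℝ)⁻¹) - ((n.choose 2 : ℕ) : ℝ)⁻¹) *
    distVarHat x

/-- `σ̂₀`. -/
def sigmaHat {n p K : ℕ} (x : Fin n → Eucl p) (y : Fin n → Fin K) : ℝ :=
  Real.sqrt (sigmaHatSq x y)

/-- The rescaled sample Gini correlation `(Δ̂ / σ̂₀) gCor_n`. -/
def rescaledGCor {n p K : ℕ} (x : Fin n → Eucl p) (y : Fin n → Fin K) : ℝ :=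
  deltaHat x / sigmaHat x y * gCorSample x y

end

end GiniCor

/-!
The weights of `gCov` have zero row sums, so only the double centered distance `d` enters it and
`gCov` is a quadratic form `½ ∑ᵢⱼ wᵢⱼ d(Xᵢ, Xⱼ)` in a degenerate kernel. Removing one observation at
a time from such a form `S` of variance one yields Stein's equation
`φ'(t) + t φ(t) = o(1)` for its characteristic function `φ`; the error is governed by the fourth
moment of `d` and by the fluctuations of the Gram matrix `∑ₖ wᵢₖ wⱼₖ d(Xᵢ, Xₖ) d(Xⱼ, Xₖ)`, whose
size is the cyclic moment. Solving the equation gives `φ(t) → exp (-t² / 2)`.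

U-centering annihilates additive matrices, so `V²ₙ` is also a function of the `d(Xᵢ, Xⱼ)` alone and
is ratio consistent for `E d²`. All bounds depend on the labels only through a lower bound for the
class proportions, so random labels are handled by conditioning on them.
-/

namespace GiniCor

section Moments

variable {Ω : Type*} [MeasurableSpace Ω] {μ : Measure Ω}

theorem integral_abs_add_le {f g : Ω → ℝ} (hf : Integrable f μ) (hg : Integrable g μ) :
    ∫ x, |f x + g x| ∂μ ≤ ∫ x, |f x| ∂μ + ∫ x, |g x| ∂μ := by
  rw [← integral_add hf.abs hg.abs]
  exact integral_mono (hf.add hg).abs (hf.abs.add hg.abs) fun x ↦ abs_add_le _ _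

theorem integral_abs_sub_le {f g : Ω → ℝ} (hf : Integrable f μ) (hg : Integrable g μ) :
    ∫ x, |f x - g x| ∂μ ≤ ∫ x, |f x| ∂μ + ∫ x, |g x| ∂μ := by
  simpa [sub_eq_add_neg] using integral_abs_add_le hf hg.neg

theorem integral_abs_mul_le {f g : Ω → ℝ} (hf : MemLp f 2 μ) (hg : MemLp g 2 μ) :
    ∫ x, |f x * g x| ∂μ ≤ √((∫ x, f x ^ 2 ∂μ) * ∫ x, g x ^ 2 ∂μ) := by
  have h := integral_mul_norm_le_Lp_mul_Lq Real.HolderConjugate.two_two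
    (by simpa using hf) (by simpa using hg)
  rw [Real.sqrt_mul (by positivity), Real.sqrt_eq_rpow, Real.sqrt_eq_rpow]
  simpa only [abs_mul, Real.norm_eq_abs, Real.rpow_two, sq_abs] using h

theorem integral_abs_le_sqrt [IsProbabilityMeasure μ] {f : Ω → ℝ} (hf : MemLp f 2 μ) :
    ∫ x, |f x| ∂μ ≤ √(∫ x, f x ^ 2 ∂μ) := by
  simpa using integral_abs_mul_le hf (memLp_const (1 : ℝ))

theorem sq_integral_le_integral_sq [IsProbabilityMeasure μ] {f : Ω → ℝ} (hf : MemLp f 2 μ) :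
    (∫ x, f x ∂μ) ^ 2 ≤ ∫ x, f x ^ 2 ∂μ := by
  have h := variance_nonneg f μ
  rw [variance_eq_sub hf] at h
  simpa using h

theorem memLp_four_iff {f : Ω → ℝ} (hf : AEStronglyMeasurable f μ) :
    MemLp f 4 μ ↔ Integrable (fun x ↦ f x ^ 4) μ := by
  rw [← integrable_norm_rpow_iff hf (by norm_num) (by norm_num)]
  have hpow (x : Ω) : ‖f x‖ ^ (4 : ENNReal).toReal = f x ^ 4 := by
    rw [show (4 : ENNReal).toReal = ((4 : ℕ) : ℝ) by norm_num, Real.rpow_natCast,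
      Real.norm_eq_abs, Even.pow_abs ⟨2, rfl⟩]
  simp_rw [hpow]

theorem memLp_two_mul {f g : Ω → ℝ} (hf : MemLp f 4 μ) (hg : MemLp g 4 μ) :
    MemLp (fun x ↦ f x * g x) 2 μ :=
  hg.mul' hf (hpqr := ⟨by
    rw [show (4 : ENNReal) = 2 * 2 by norm_num, ENNReal.mul_inv (by simp) (by simp), ← two_mul,
      ← mul_assoc, ENNReal.mul_inv_cancel (by simp) (by simp), one_mul]⟩)

theorem memLp_two_of_four [IsFiniteMeasure μ] {f : Ω → ℝ} (hf : MemLp f 4 μ) : MemLp f 2 μ :=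
  hf.mono_exponent (by norm_num)

theorem integral_sq_sum_le_of_ncard {κ : Type*} [Fintype κ] {f : κ → Ω → ℝ} {D : ℕ}
    (hf : ∀ q, MemLp (f q) 2 μ)
    (hD : ∀ q, {r | ∫ x, f q x * f r x ∂μ ≠ 0}.ncard ≤ D) :
    ∫ x, (∑ q, f q x) ^ 2 ∂μ ≤ D * ∑ q, ∫ x, f q x ^ 2 ∂μ := by
  classical
  let N (q : κ) : Finset κ := {r | ∫ x, f q x * f r x ∂μ ≠ 0}
  have hN (q : κ) : ((N q).card : ℝ) ≤ D := by
    rw [Nat.cast_le, ← Set.ncard_coe_finset]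
    simpa [N] using hD q
  have hint (q r : κ) : Integrable (fun x ↦ f q x * f r x) μ := (hf q).integrable_mul (hf r)
  have hNcomm (q r : κ) : r ∈ N q ↔ q ∈ N r := by simp [N, mul_comm]
  have hpair (q r : κ) : ∫ x, f q x * f r x ∂μ ≤
      (∫ x, f q x ^ 2 ∂μ + ∫ x, f r x ^ 2 ∂μ) / 2 := by
    rw [← integral_add (hf q).integrable_sq (hf r).integrable_sq, ← integral_div]
    refine integral_mono (hint q r) (((hf q).integrable_sq.add (hf r).integrable_sq).div_const 2)
      fun x ↦ ?_
    dsimp only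
    linarith [two_mul_le_add_sq (f q x) (f r x)]
  calc ∫ x, (∑ q, f q x) ^ 2 ∂μ = ∑ q, ∑ r ∈ N q, ∫ x, f q x * f r x ∂μ := by
        simp_rw [sq, Finset.sum_mul_sum]
        rw [integral_finsetSum _ fun q _ ↦ integrable_finsetSum _ fun r _ ↦ hint q r]
        refine Finset.sum_congr rfl fun q _ ↦ ?_
        rw [integral_finsetSum _ fun r _ ↦ hint q r, Finset.sum_filter_ne_zero]
    _ ≤ ∑ q, ∑ r ∈ N q, (∫ x, f q x ^ 2 ∂μ + ∫ x, f r x ^ 2 ∂μ) / 2 :=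
        Finset.sum_le_sum fun q _ ↦ Finset.sum_le_sum fun r _ ↦ hpair q r
    _ = ∑ q, (N q).card * ∫ x, f q x ^ 2 ∂μ := by
        have hswap : ∑ q, ∑ r ∈ N q, ∫ x, f r x ^ 2 ∂μ = ∑ q, ∑ _r ∈ N q, ∫ x, f q x ^ 2 ∂μ :=
          Finset.sum_comm' fun q r ↦ by simpa using hNcomm q r
        simp_rw [← Finset.sum_div, Finset.sum_add_distrib, hswap, Finset.sum_const, nsmul_eq_mul,
          add_self_div_two]
    _ ≤ D * ∑ q, ∫ x, f q x ^ 2 ∂μ := by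
        rw [Finset.mul_sum]
        exact Finset.sum_le_sum fun q _ ↦
          mul_le_mul_of_nonneg_right (hN q) (integral_nonneg fun x ↦ sq_nonneg _)

end Moments

section ProductMeasure

variable {ι : Type*} [Fintype ι]

section Update

variable {E : ι → Type*} [∀ i, MeasurableSpace (E i)] {μ : ∀ i, Measure (E i)}
  [∀ i, IsProbabilityMeasure (μ i)] [DecidableEq ι]

theorem measurePreserving_update (μ : ∀ i, Measure (E i)) [∀ i, IsProbabilityMeasure (μ i)]
    (i : ι) :
    MeasurePreserving (fun q : (∀ j, E j) × E i ↦ Function.update q.1 i q.2)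
      ((Measure.pi μ).prod (μ i)) (Measure.pi μ) := by
  have hm : Measurable fun q : (∀ j, E j) × E i ↦ Function.update q.1 i q.2 := measurable_update'
  refine ⟨hm, (Measure.pi_eq fun s hs ↦ ?_).symm⟩
  have hpre : (fun q : (∀ j, E j) × E i ↦ Function.update q.1 i q.2) ⁻¹' Set.univ.pi s =
      Set.univ.pi (Function.update s i Set.univ) ×ˢ s i := by
    ext q
    simp only [Set.mem_preimage, Set.mem_univ_pi, Set.mem_prod,
      Function.forall_update_iff q.1 fun j y ↦ y ∈ s j,
      Function.forall_update_iff s fun j t ↦ q.1 j ∈ t, Set.mem_univ, true_and]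
    exact and_comm
  rw [Measure.map_apply hm (.univ_pi hs), hpre, Measure.prod_prod, Measure.pi_pi,
    ← Finset.prod_erase_mul _ _ (Finset.mem_univ i),
    ← Finset.prod_erase_mul _ (fun i ↦ μ i (s i)) (Finset.mem_univ i), Function.update_self,
    measure_univ, mul_one]
  congr 1
  exact Finset.prod_congr rfl fun j hj ↦ by rw [Function.update_of_ne (Finset.ne_of_mem_erase hj)]

theorem integral_update {G : Type*} [NormedAddCommGroup G] [NormedSpace ℝ G]
    {f : (∀ i, E i) → G} (hf : Integrable f (Measure.pi μ)) (i : ι) :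
    ∫ x, f x ∂Measure.pi μ = ∫ x, ∫ z, f (Function.update x i z) ∂μ i ∂Measure.pi μ := by
  have hmp := measurePreserving_update μ i
  rw [← integral_prod (fun q ↦ f (Function.update q.1 i q.2))
    (hmp.integrable_comp_of_integrable hf)]
  exact (HasLaw.mk hmp.aemeasurable hmp.map_eq).integral_comp hf.aestronglyMeasurable |>.symm

theorem integral_mul_eq_zero_of_update {𝕜 : Type*} [RCLike 𝕜] {f g : (∀ i, E i) → 𝕜} (i : ι)
    (hfg : Integrable (fun x ↦ f x * g x) (Measure.pi μ))
    (hf : ∀ x z, f (Function.update x i z) = f x)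
    (hg : ∀ x, ∫ z, g (Function.update x i z) ∂μ i = 0) :
    ∫ x, f x * g x ∂Measure.pi μ = 0 := by
  rw [integral_update hfg i]
  simp_rw [hf, integral_const_mul, hg, mul_zero, integral_zero]

end Update

variable {E : Type*} [MeasurableSpace E]

variable (ι) in
/-- The law `F^ι` of a family, indexed by `ι`, of independent observations with law `F`. -/
noncomputable abbrev iidLaw (F : Measure E) : Measure (ι → E) :=
  Measure.pi fun _ ↦ F

variable {F : Measure E} [IsProbabilityMeasure F]

theorem hasLaw_eval (F : Measure E) [IsProbabilityMeasure F] (i : ι) :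
    HasLaw (fun x : ι → E ↦ x i) F (iidLaw ι F) :=
  (measurePreserving_eval (fun _ ↦ F) i).hasLaw

theorem hasLaw_pair (F : Measure E) [IsProbabilityMeasure F] {i j : ι} (hij : i ≠ j) :
    HasLaw (fun x : ι → E ↦ (x i, x j)) (F.prod F) (iidLaw ι F) :=
  (indepFun_iff_hasLaw_prodMk_prod (hasLaw_eval F i) (hasLaw_eval F j)).1
    ((iIndepFun_pi (μ := fun _ : ι ↦ F) (X := fun _ ↦ id) fun _ ↦ aemeasurable_id).indepFun hij)

theorem memLp_eval {k : E → ℝ} {r : ENNReal} (hk : MemLp k r F) (i : ι) :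
    MemLp (fun x : ι → E ↦ k (x i)) r (iidLaw ι F) :=
  hk.comp_measurePreserving (measurePreserving_eval (fun _ ↦ F) i)

theorem integral_eval {k : E → ℝ} (hk : AEStronglyMeasurable k F) (i : ι) :
    ∫ x, k (x i) ∂iidLaw ι F = ∫ z, k z ∂F :=
  (hasLaw_eval F i).integral_comp hk

theorem memLp_pair {k : E → E → ℝ} {r : ENNReal} (hk : MemLp (Function.uncurry k) r (F.prod F))
    {i j : ι} (hij : i ≠ j) :
    MemLp (fun x : ι → E ↦ k (x i) (x j)) r (iidLaw ι F) :=
  hk.comp_measurePreserving ⟨by fun_prop, (hasLaw_pair F hij).map_eq⟩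

theorem integral_pair {k : E → E → ℝ}
    (hk : AEStronglyMeasurable (Function.uncurry k) (F.prod F)) {i j : ι} (hij : i ≠ j) :
    ∫ x, k (x i) (x j) ∂iidLaw ι F = ∫ z, k z.1 z.2 ∂F.prod F :=
  (hasLaw_pair F hij).integral_comp hk

end ProductMeasure

section WeightedSums

variable {ι E : Type*} [Fintype ι] [MeasurableSpace E] {F : Measure E} [IsProbabilityMeasure F]

theorem integral_pair_mul_pair_eq_zero {k : E → E → ℝ} (hsymm : ∀ x y, k x y = k y x)
    (hk : MemLp (Function.uncurry k) 2 (F.prod F)) (hcent : ∀ x, ∫ z, k x z ∂F = 0)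
    {i j i' j' : ι} (hij : i ≠ j) (hij' : i' ≠ j') (hne : s(i, j) ≠ s(i', j')) :
    ∫ x, k (x i) (x j) * k (x i') (x j') ∂iidLaw ι F = 0 := by
  classical
  wlog hi : i ≠ i' ∧ i ≠ j' generalizing i j
  · have hj : j ≠ i' ∧ j ≠ j' := by grind
    simpa only [hsymm] using this hij.symm (by rwa [Sym2.eq_swap]) hj
  rw [funext fun x : ι → E ↦ mul_comm (k (x i) (x j)) (k (x i') (x j'))]
  refine integral_mul_eq_zero_of_update i
    ((memLp_pair hk hij').integrable_mul (memLp_pair hk hij)) (fun x z ↦ ?_) fun x ↦ ?_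
  · rw [Function.update_of_ne hi.1.symm, Function.update_of_ne hi.2.symm]
  · simp_rw [Function.update_self, Function.update_of_ne hij.symm, hsymm _ (x j), hcent]

theorem integral_sq_sum_pair_le {k : E → E → ℝ} (hsymm : ∀ x y, k x y = k y x)
    (hk : MemLp (Function.uncurry k) 2 (F.prod F)) (hcent : ∀ x, ∫ z, k x z ∂F = 0)
    {c : ι → ι → ℝ} (hc : ∀ i, c i i = 0) :
    ∫ x, (∑ i, ∑ j, c i j * k (x i) (x j)) ^ 2 ∂iidLaw ι F ≤
      2 * ((∑ i, ∑ j, c i j ^ 2) * ∫ z, k z.1 z.2 ^ 2 ∂F.prod F) := by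
  let f (q : ι × ι) (x : ι → E) : ℝ := c q.1 q.2 * k (x q.1) (x q.2)
  have hf (q : ι × ι) : MemLp (f q) 2 (iidLaw ι F) := by
    obtain hq | hq := eq_or_ne q.1 q.2
    · simp [f, hq, hc]
    · exact (memLp_pair hk hq).const_mul _
  have hf2 (q : ι × ι) :
      ∫ x, f q x ^ 2 ∂iidLaw ι F = c q.1 q.2 ^ 2 * ∫ z, k z.1 z.2 ^ 2 ∂F.prod F := by
    simp_rw [f, mul_pow, integral_const_mul]
    obtain hq | hq := eq_or_ne q.1 q.2
    · simp [hq, hc]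
    · rw [integral_pair (k := fun x y ↦ k x y ^ 2) (hk.aestronglyMeasurable.fun_pow 2) hq]
  have horth (q : ι × ι) : {r | ∫ x, f q x * f r x ∂iidLaw ι F ≠ 0} ⊆ {q, q.swap} := by
    intro r hr
    by_contra hqr
    apply hr
    simp_rw [f, mul_mul_mul_comm, integral_const_mul]
    obtain hq | hq := eq_or_ne q.1 q.2
    · simp [hq, hc]
    obtain hr | hr := eq_or_ne r.1 r.2
    · simp [hr, hc]
    rw [integral_pair_mul_pair_eq_zero hsymm hk hcent hq hr (by aesop), mul_zero]
  calc ∫ x, (∑ i, ∑ j, c i j * k (x i) (x j)) ^ 2 ∂iidLaw ι F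
      = ∫ x, (∑ q, f q x) ^ 2 ∂iidLaw ι F := by simp_rw [f, Fintype.sum_prod_type]
    _ ≤ (2 : ℕ) * ∑ q, ∫ x, f q x ^ 2 ∂iidLaw ι F :=
        integral_sq_sum_le_of_ncard hf fun q ↦
          (Set.ncard_le_ncard (horth q)).trans (Set.ncard_insert_le _ _ |>.trans (by simp))
    _ = _ := by simp_rw [hf2, ← Finset.sum_mul, Fintype.sum_prod_type, Nat.cast_ofNat]

theorem integral_sq_sum_eval_le {k : E → ℝ} (hk : MemLp k 2 F) (hcent : ∫ z, k z ∂F = 0)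
    (c : ι → ℝ) :
    ∫ x, (∑ i, c i * k (x i)) ^ 2 ∂iidLaw ι F ≤ (∑ i, c i ^ 2) * ∫ z, k z ^ 2 ∂F := by
  classical
  have hf (i : ι) : MemLp (fun x ↦ c i * k (x i)) 2 (iidLaw ι F) := (memLp_eval hk i).const_mul _
  have horth (i : ι) :
      {j | ∫ x, c i * k (x i) * (c j * k (x j)) ∂iidLaw ι F ≠ 0} ⊆ {i} := by
    intro j hj
    by_contra hji
    refine hj (integral_mul_eq_zero_of_update j ((hf i).integrable_mul (hf j)) (fun x z ↦ ?_)
      fun x ↦ ?_)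
    · rw [Function.update_of_ne (Ne.symm hji)]
    · simp_rw [Function.update_self, integral_const_mul, hcent, mul_zero]
  refine (integral_sq_sum_le_of_ncard (D := 1) hf fun i ↦
    (Set.ncard_le_ncard (horth i)).trans (Set.ncard_singleton i).le).trans_eq ?_
  simp_rw [mul_pow, integral_const_mul, Nat.cast_one, one_mul, Finset.sum_mul]
  exact Finset.sum_congr rfl fun i _ ↦ by
    rw [integral_eval (k := fun z ↦ k z ^ 2) (hk.aestronglyMeasurable.pow 2)]

end WeightedSums

section DegenerateKernel

variable {E : Type*} [MeasurableSpace E] {F : Measure E}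

/-- A symmetric kernel `h` is degenerate for `F` if `E h(x, X) = 0` for every `x`, where `X ∼ F`.
Its fourth moments are controlled by a domination `|h x y| ≤ A x * A y` with `A` in `L⁴`, which
makes every section `h x` integrable and not merely almost every one. -/
structure IsDegenerateKernel (F : Measure E) (h : E → E → ℝ) : Prop where
  measurable : Measurable (Function.uncurry h)
  symm : ∀ x y, h x y = h y x
  exists_bound : ∃ A : E → ℝ, MemLp A 4 F ∧ ∀ x y, |h x y| ≤ A x * A y
  integral_eq_zero : ∀ x, ∫ z, h x z ∂F = 0

/-- The kernel `G(x, y) = E h(x, X) h(y, X)`, `X ∼ F`, of the square of the integral operator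
of `h`. -/
noncomputable def gram (F : Measure E) (h : E → E → ℝ) (x y : E) : ℝ :=
  ∫ z, h x z * h y z ∂F

theorem gram_comm (F : Measure E) (h : E → E → ℝ) (x y : E) : gram F h x y = gram F h y x := by
  simp only [gram, mul_comm]

theorem memLp_four_mul_prod [SFinite F] {A : E → ℝ} (hA : MemLp A 4 F) :
    MemLp (fun q : E × E ↦ A q.1 * A q.2) 4 (F.prod F) := by
  rw [memLp_four_iff (hA.aestronglyMeasurable.comp_fst.fun_mul hA.aestronglyMeasurable.comp_snd)]
  simp_rw [mul_pow]
  have hA4 := (memLp_four_iff hA.aestronglyMeasurable).1 hA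
  exact hA4.mul_prod hA4

namespace IsDegenerateKernel

variable {h : E → E → ℝ} (hh : IsDegenerateKernel F h)
include hh

theorem measurable_right (x : E) : Measurable (h x) :=
  hh.measurable.comp measurable_prodMk_left

theorem memLp_right (x : E) : MemLp (h x) 4 F := by
  obtain ⟨A, hA, hhA⟩ := hh.exists_bound
  exact (hA.const_mul (A x)).mono' (hh.measurable_right x).aestronglyMeasurable
    (ae_of_all _ fun y ↦ hhA x y)

theorem memLp [SFinite F] : MemLp (Function.uncurry h) 4 (F.prod F) := by
  obtain ⟨A, hA, hhA⟩ := hh.exists_bound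
  exact (memLp_four_mul_prod hA).mono' hh.measurable.aestronglyMeasurable
    (ae_of_all _ fun q ↦ hhA q.1 q.2)

theorem measurable_gram [SFinite F] : Measurable (Function.uncurry (gram F h)) := by
  have hm : Measurable fun q : (E × E) × E ↦ h q.1.1 q.2 * h q.1.2 q.2 :=
    (hh.measurable.comp (measurable_fst.fst.prodMk measurable_snd)).mul
      (hh.measurable.comp (measurable_fst.snd.prodMk measurable_snd))
  exact hm.stronglyMeasurable.integral_prod_right'.measurable

variable [IsFiniteMeasure F]

theorem exists_gram_bound : ∃ A : E → ℝ, MemLp A 4 F ∧ ∀ x y, |gram F h x y| ≤ A x * A y := by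
  obtain ⟨A, hA, hhA⟩ := hh.exists_bound
  have hA2 := (memLp_two_of_four hA).integrable_sq
  refine ⟨fun x ↦ √(∫ z, A z ^ 2 ∂F) * A x, hA.const_mul _, fun x y ↦ ?_⟩
  calc |gram F h x y| ≤ ∫ z, |h x z * h y z| ∂F := abs_integral_le_integral_abs
    _ ≤ ∫ z, A x * A y * A z ^ 2 ∂F := by
        refine integral_mono_of_nonneg (ae_of_all _ fun z ↦ abs_nonneg _) (hA2.const_mul _)
          (ae_of_all _ fun z ↦ ?_)
        calc |h x z * h y z| = |h x z| * |h y z| := abs_mul _ _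
          _ ≤ A x * A z * (A y * A z) :=
              mul_le_mul (hhA x z) (hhA y z) (abs_nonneg _) ((abs_nonneg _).trans (hhA x z))
          _ = A x * A y * A z ^ 2 := by ring
    _ = √(∫ z, A z ^ 2 ∂F) ^ 2 * (A x * A y) := by
        rw [integral_const_mul, Real.sq_sqrt (integral_nonneg fun _ ↦ sq_nonneg _), mul_comm]
    _ = √(∫ z, A z ^ 2 ∂F) * A x * (√(∫ z, A z ^ 2 ∂F) * A y) := by ring

theorem memLp_gram : MemLp (Function.uncurry (gram F h)) 2 (F.prod F) := by
  obtain ⟨A, hA, hgA⟩ := hh.exists_gram_bound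
  exact memLp_two_of_four ((memLp_four_mul_prod hA).mono' hh.measurable_gram.aestronglyMeasurable
    (ae_of_all _ fun q ↦ hgA q.1 q.2))

theorem memLp_gram_diag : MemLp (fun x ↦ gram F h x x) 2 F := by
  obtain ⟨A, hA, hgA⟩ := hh.exists_gram_bound
  exact (memLp_two_mul hA hA).mono' (hh.measurable_gram.comp
    (measurable_id.prodMk measurable_id)).aestronglyMeasurable (ae_of_all _ fun x ↦ hgA x x)

theorem integral_gram_eq_zero (x : E) : ∫ y, gram F h x y ∂F = 0 := by
  have hint : Integrable (Function.uncurry fun y z ↦ h x z * h y z) (F.prod F) :=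
    ((memLp_two_of_four (hh.memLp_right x)).comp_snd F).integrable_mul (memLp_two_of_four hh.memLp)
  simp_rw [gram, integral_integral_swap hint, integral_const_mul, hh.symm _ (_ : E),
    hh.integral_eq_zero, mul_zero, integral_zero]

theorem integral_gram_diag : ∫ x, gram F h x x ∂F = ∫ q, h q.1 q.2 ^ 2 ∂F.prod F := by
  rw [integral_prod (fun q ↦ h q.1 q.2 ^ 2) (memLp_two_of_four hh.memLp).integrable_sq]
  simp_rw [gram, sq]

omit [IsFiniteMeasure F] in
theorem integral_gram_diag_sq_le [IsProbabilityMeasure F] :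
    ∫ x, gram F h x x ^ 2 ∂F ≤ ∫ q, h q.1 q.2 ^ 4 ∂F.prod F := by
  have hi : Integrable (fun q : E × E ↦ h q.1 q.2 ^ 4) (F.prod F) :=
    (memLp_four_iff hh.memLp.aestronglyMeasurable).1 hh.memLp
  rw [integral_prod _ hi]
  refine integral_mono hh.memLp_gram_diag.integrable_sq hi.integral_prod_left fun x ↦ ?_
  calc gram F h x x ^ 2 ≤ ∫ z, (h x z * h x z) ^ 2 ∂F :=
        sq_integral_le_integral_sq (memLp_two_mul (hh.memLp_right x) (hh.memLp_right x))
    _ = ∫ z, h x z ^ 4 ∂F := by ring_nf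

end IsDegenerateKernel

end DegenerateKernel

section CircleExp

theorem norm_circleExp_sub_one_le (u : ℝ) : ‖(Circle.exp u : ℂ) - 1‖ ≤ |u| := by
  rw [Circle.coe_exp, mul_comm]
  exact Real.norm_exp_I_mul_ofReal_sub_one_le

theorem norm_circleExp_sub_one_sub_le (u : ℝ) :
    ‖(Circle.exp u : ℂ) - 1 - u * Complex.I‖ ≤ 2 * u ^ 2 := by
  have hn : ‖(u : ℂ) * Complex.I‖ = |u| := by simp
  obtain h | h := le_total |u| 1
  · rw [Circle.coe_exp]
    refine (Complex.norm_exp_sub_one_sub_id_le (by rwa [hn])).trans ?_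
    rw [hn, sq_abs]
    nlinarith [sq_nonneg u]
  · calc ‖(Circle.exp u : ℂ) - 1 - u * Complex.I‖
        ≤ ‖(Circle.exp u : ℂ) - 1‖ + ‖(u : ℂ) * Complex.I‖ := norm_sub_le _ _
      _ ≤ |u| + |u| := add_le_add (norm_circleExp_sub_one_le u) hn.le
      _ ≤ 2 * u ^ 2 := by rw [← sq_abs]; nlinarith

variable {Ω : Type*} [MeasurableSpace Ω] {μ : Measure Ω} {S f : Ω → ℝ}

theorem aestronglyMeasurable_circleExp (hS : AEStronglyMeasurable S μ) :
    AEStronglyMeasurable (fun x ↦ (Circle.exp (S x) : ℂ)) μ :=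
  (continuous_subtype_val.comp Circle.exp.continuous).comp_aestronglyMeasurable hS

theorem integrable_circleExp_mul (hS : AEStronglyMeasurable S μ) (hf : Integrable f μ) :
    Integrable (fun x ↦ (Circle.exp (S x) : ℂ) * (f x : ℂ)) μ :=
  hf.ofReal.bdd_mul (c := 1) (aestronglyMeasurable_circleExp hS)
    (ae_of_all _ fun _ ↦ (Circle.norm_coe _).le)

theorem charFun_map_real (hS : AEMeasurable S μ) (t : ℝ) :
    charFun (μ.map S) t = ∫ x, (Circle.exp (t * S x) : ℂ) ∂μ := by
  rw [charFun_apply_real, integral_map hS (by fun_prop)]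
  simp_rw [Circle.coe_exp, Complex.ofReal_mul]

end CircleExp

section Stein

variable {Ω : Type*} [MeasurableSpace Ω] {μ : Measure Ω}

theorem norm_circleExp_mul_sub_le (t r l γ : ℝ) :
    ‖(Circle.exp (t * (r + l)) : ℂ) * l -
        t * Complex.I * ((Circle.exp (t * (r + l)) : ℂ) * γ) -
        ((Circle.exp (t * r) : ℂ) * l + t * Complex.I * ((Circle.exp (t * r) : ℂ) *
          ((l ^ 2 : ℝ) : ℂ) - (Circle.exp (t * r) : ℂ) * γ))‖ ≤
      t ^ 2 * (2 * |l * l ^ 2| + |γ * l|) := by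
  have hfactor : (Circle.exp (t * (r + l)) : ℂ) * l -
        t * Complex.I * ((Circle.exp (t * (r + l)) : ℂ) * γ) -
        ((Circle.exp (t * r) : ℂ) * l + t * Complex.I * ((Circle.exp (t * r) : ℂ) *
          ((l ^ 2 : ℝ) : ℂ) - (Circle.exp (t * r) : ℂ) * γ)) =
      (Circle.exp (t * r) : ℂ) * (l * ((Circle.exp (t * l) : ℂ) - 1 - (t * l : ℝ) * Complex.I) -
        t * Complex.I * γ * ((Circle.exp (t * l) : ℂ) - 1)) := by
    rw [mul_add, Circle.exp_add, Circle.coe_mul]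
    push_cast
    ring
  rw [hfactor, norm_mul, Circle.norm_coe, one_mul]
  calc _ ≤ |l| * (2 * (t * l) ^ 2) + |t| * |γ| * |t * l| := by
        refine (norm_sub_le _ _).trans (add_le_add ?_ ?_)
        · rw [norm_mul, Complex.norm_real, Real.norm_eq_abs]
          gcongr
          exact norm_circleExp_sub_one_sub_le _
        · rw [norm_mul, norm_mul, norm_mul, Complex.norm_real, Complex.norm_real,
            Complex.norm_I, mul_one, Real.norm_eq_abs, Real.norm_eq_abs]
          gcongr
          exact norm_circleExp_sub_one_le _
    _ = t ^ 2 * (2 * |l * l ^ 2| + |γ * l|) := by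
        simp only [abs_mul, abs_pow, sq_abs, mul_pow]
        rw [← sq_abs t]
        ring

-- `Γ` plays the role of the conditional second moment of `L` given `R`, which enters only through
-- `hL1`, `hL2` and `hΓ2`.
theorem norm_integral_circleExp_mul_sub_le {L Γ R : Ω → ℝ} (t : ℝ) [IsFiniteMeasure μ]
    (hL : MemLp L 4 μ) (hΓ : MemLp Γ 2 μ)
    (hR : AEStronglyMeasurable R μ)
    (hL1 : ∫ x, (Circle.exp (t * R x) : ℂ) * (L x : ℂ) ∂μ = 0)
    (hL2 : ∫ x, (Circle.exp (t * R x) : ℂ) * ((L x ^ 2 : ℝ) : ℂ) ∂μ =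
      ∫ x, (Circle.exp (t * R x) : ℂ) * (Γ x : ℂ) ∂μ)
    (hΓ2 : ∫ x, Γ x ^ 2 ∂μ ≤ ∫ x, L x ^ 4 ∂μ) :
    ‖∫ x, (Circle.exp (t * (R x + L x)) : ℂ) * (L x : ℂ) ∂μ -
        t * Complex.I * ∫ x, (Circle.exp (t * (R x + L x)) : ℂ) * (Γ x : ℂ) ∂μ‖ ≤
      3 * t ^ 2 * √((∫ x, L x ^ 2 ∂μ) * ∫ x, L x ^ 4 ∂μ) := by
  have hL' := memLp_two_of_four hL
  have hLsq : MemLp (fun x ↦ L x ^ 2) 2 μ := by simpa only [sq] using memLp_two_mul hL hL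
  have hRt : AEStronglyMeasurable (fun x ↦ t * R x) μ := hR.const_mul t
  have hSt : AEStronglyMeasurable (fun x ↦ t * (R x + L x)) μ :=
    (hR.add hL.aestronglyMeasurable).const_mul t
  have hRL := integrable_circleExp_mul hRt (hL'.integrable one_le_two)
  have hRL2 := integrable_circleExp_mul hRt hL'.integrable_sq
  have hRΓ := integrable_circleExp_mul hRt (hΓ.integrable one_le_two)
  have hSL := integrable_circleExp_mul hSt (hL'.integrable one_le_two)
  have hSΓ := (integrable_circleExp_mul hSt (hΓ.integrable one_le_two)).const_mul (t * Complex.I)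
  have hRdiff := (hRL2.sub' hRΓ).const_mul (t * Complex.I)
  have hcubic : ∫ x, |L x * L x ^ 2| ∂μ ≤ √((∫ x, L x ^ 2 ∂μ) * ∫ x, L x ^ 4 ∂μ) := by
    simpa only [← pow_mul] using integral_abs_mul_le hL' hLsq
  have hmixed : ∫ x, |Γ x * L x| ∂μ ≤ √((∫ x, L x ^ 2 ∂μ) * ∫ x, L x ^ 4 ∂μ) := by
    refine (integral_abs_mul_le hΓ hL').trans (Real.sqrt_le_sqrt ?_)
    rw [mul_comm]
    gcongr
  have hcubic_int : Integrable (fun x ↦ 2 * |L x * L x ^ 2|) μ :=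
    (hL'.integrable_mul hLsq).abs.const_mul 2
  have hmixed_int : Integrable (fun x ↦ |Γ x * L x|) μ := (hΓ.integrable_mul hL').abs
  calc _ = ‖∫ x, ((Circle.exp (t * (R x + L x)) : ℂ) * L x -
        t * Complex.I * ((Circle.exp (t * (R x + L x)) : ℂ) * Γ x) -
        ((Circle.exp (t * R x) : ℂ) * L x + t * Complex.I * ((Circle.exp (t * R x) : ℂ) *
          ((L x ^ 2 : ℝ) : ℂ) - (Circle.exp (t * R x) : ℂ) * Γ x))) ∂μ‖ := by
        rw [integral_sub (hSL.sub' hSΓ) (hRL.fun_add hRdiff), integral_sub hSL hSΓ,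
          integral_add hRL hRdiff, integral_const_mul, integral_const_mul,
          integral_sub hRL2 hRΓ, hL1, hL2, sub_self, mul_zero, add_zero, sub_zero]
    _ ≤ ∫ x, t ^ 2 * (2 * |L x * L x ^ 2| + |Γ x * L x|) ∂μ :=
        norm_integral_le_of_norm_le ((hcubic_int.add hmixed_int).const_mul _)
          (ae_of_all _ fun x ↦ norm_circleExp_mul_sub_le t (R x) (L x) (Γ x))
    _ = t ^ 2 * (2 * ∫ x, |L x * L x ^ 2| ∂μ + ∫ x, |Γ x * L x| ∂μ) := by
        rw [integral_const_mul, integral_add hcubic_int hmixed_int, integral_const_mul]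
    _ ≤ t ^ 2 * (2 * √((∫ x, L x ^ 2 ∂μ) * ∫ x, L x ^ 4 ∂μ) +
          √((∫ x, L x ^ 2 ∂μ) * ∫ x, L x ^ 4 ∂μ)) := by gcongr
    _ = _ := by ring

theorem hasDerivAt_charFun {ν : Measure ℝ} [IsProbabilityMeasure ν] (hν : MemLp id 1 ν) (s : ℝ) :
    HasDerivAt (charFun ν)
      (Complex.I * ∫ x, (Circle.exp (s * x) : ℂ) * (x : ℂ) ∂ν) s := by
  have hd : DifferentiableAt ℝ (charFun ν) s :=
    (contDiff_charFun (n := 1) (by simpa using hν)).differentiable one_ne_zero s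
  convert! hd.hasDerivAt using 1
  rw [← iteratedDeriv_one, iteratedDeriv_charFun (by simpa using hν)]
  simp [Circle.coe_exp, mul_comm]

/- The Gaussian characteristic function solves `φ' = -s φ`; an approximate solution of this equation
is compared with it by differentiating `φ(s) exp(s² / 2)`. -/
theorem norm_charFun_sub_charFun_gaussianReal_le {ν : Measure ℝ} [IsProbabilityMeasure ν]
    (hν : MemLp id 1 ν) {C : ℝ} (t : ℝ)
    (hC : ∀ s : ℝ, |s| ≤ |t| → ‖∫ x, (Circle.exp (s * x) : ℂ) * (x : ℂ) ∂ν -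
        s * Complex.I * charFun ν s‖ ≤ C) :
    ‖charFun ν t - charFun (gaussianReal 0 1) t‖ ≤ |t| * C := by
  let D (s : ℝ) : ℂ := ∫ x, (Circle.exp (s * x) : ℂ) * (x : ℂ) ∂ν - s * Complex.I * charFun ν s
  have hderiv (s : ℝ) : HasDerivAt (fun s : ℝ ↦ charFun ν s * (Real.exp (s ^ 2 / 2) : ℂ))
      (Complex.I * D s * (Real.exp (s ^ 2 / 2) : ℂ)) s := by
    have hexp := (((hasDerivAt_pow 2 s).div_const 2).exp).ofReal_comp
    convert! (hasDerivAt_charFun hν s).mul hexp using 1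
    simp only [D]
    push_cast
    linear_combination (-(s : ℂ) * charFun ν s * Complex.exp ((s : ℂ) ^ 2 / 2)) * Complex.I_mul_I
  have hbound (s : ℝ) (hs : s ∈ Set.uIcc 0 t) :
      ‖Complex.I * D s * (Real.exp (s ^ 2 / 2) : ℂ)‖ ≤ C * Real.exp (t ^ 2 / 2) := by
    have hst : |s| ≤ |t| := by simpa using Set.abs_sub_left_of_mem_uIcc hs
    rw [norm_mul, norm_mul, Complex.norm_I, one_mul, Complex.norm_real,
      Real.norm_of_nonneg (Real.exp_pos _).le]
    have := sq_le_sq.2 hst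
    gcongr
    · exact (norm_nonneg _).trans (hC t le_rfl)
    · exact hC s hst
  have hmv := (convex_uIcc (0 : ℝ) t).norm_image_sub_le_of_norm_hasDerivWithin_le
    (fun s _ ↦ (hderiv s).hasDerivWithinAt) hbound Set.left_mem_uIcc Set.right_mem_uIcc
  have hgauss : charFun (gaussianReal 0 1) t = (Real.exp (-(t ^ 2 / 2)) : ℂ) := by
    rw [charFun_gaussianReal]
    simp
  have hcancel : Real.exp (t ^ 2 / 2) * Real.exp (-(t ^ 2 / 2)) = 1 := by
    rw [← Real.exp_add, add_neg_cancel, Real.exp_zero]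
  have hfactor : charFun ν t - charFun (gaussianReal 0 1) t =
      (charFun ν t * (Real.exp (t ^ 2 / 2) : ℂ) - charFun ν 0 * (Real.exp (0 ^ 2 / 2) : ℂ)) *
        (Real.exp (-(t ^ 2 / 2)) : ℂ) := by
    rw [hgauss, sub_mul, mul_assoc, ← Complex.ofReal_mul, hcancel]
    simp
  rw [hfactor, norm_mul, Complex.norm_real, Real.norm_of_nonneg (Real.exp_pos _).le]
  calc _ ≤ C * Real.exp (t ^ 2 / 2) * ‖t - 0‖ * Real.exp (-(t ^ 2 / 2)) := by gcongr
    _ = |t| * C * (Real.exp (t ^ 2 / 2) * Real.exp (-(t ^ 2 / 2))) := by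
        rw [sub_zero, Real.norm_eq_abs]
        ring
    _ = |t| * C := by rw [hcancel, mul_one]

end Stein

section FourthMoment

theorem add_pow_four_le {k : ℝ} (hk : 0 < k) (u v : ℝ) :
    (u + v) ^ 4 ≤ (1 + 1 / k) * u ^ 4 + (16 * k + 3) * v ^ 4 + 4 * (u ^ 3 * v) := by
  have hsq : (1 + 1 / k) * u ^ 4 + (16 * k + 3) * v ^ 4 + 4 * (u ^ 3 * v) - (u + v) ^ 4 =
      1 / k * (u ^ 2 - 4 * k * v ^ 2) ^ 2 + 2 * v ^ 2 * (u - v) ^ 2 := by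
    field_simp
    ring
  have hnonneg : 0 ≤ 1 / k * (u ^ 2 - 4 * k * v ^ 2) ^ 2 + 2 * v ^ 2 * (u - v) ^ 2 := by
    positivity
  linarith

variable {Ω : Type*} [MeasurableSpace Ω] {μ : Measure Ω}

theorem integral_pow_four_add_le {f g : Ω → ℝ} (hf : MemLp f 4 μ) (hg : MemLp g 4 μ)
    (hfg : ∫ x, f x ^ 3 * g x ∂μ = 0) {k : ℝ} (hk : 0 < k) :
    ∫ x, (f x + g x) ^ 4 ∂μ ≤
      (1 + 1 / k) * ∫ x, f x ^ 4 ∂μ + (16 * k + 3) * ∫ x, g x ^ 4 ∂μ := by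
  have hpow {u : Ω → ℝ} (hu : MemLp u 4 μ) : Integrable (fun x ↦ u x ^ 4) μ :=
    (memLp_four_iff hu.aestronglyMeasurable).1 hu
  have hf4 := (hpow hf).const_mul (1 + 1 / k)
  have hg4 := (hpow hg).const_mul (16 * k + 3)
  have hcross : Integrable (fun x ↦ 4 * (f x ^ 3 * g x)) μ := by
    refine Integrable.const_mul ?_ 4
    refine ((memLp_two_mul hf hf).integrable_mul (memLp_two_mul hf hg)).congr
      (ae_of_all _ fun x ↦ ?_)
    simp only [Pi.mul_apply]
    ring
  calc ∫ x, (f x + g x) ^ 4 ∂μ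
      ≤ ∫ x, ((1 + 1 / k) * f x ^ 4 + (16 * k + 3) * g x ^ 4 + 4 * (f x ^ 3 * g x)) ∂μ :=
        integral_mono (hpow (hf.add hg)) ((hf4.fun_add hg4).fun_add hcross)
          fun x ↦ add_pow_four_le hk (f x) (g x)
    _ = _ := by
        rw [integral_add (hf4.fun_add hg4) hcross, integral_add hf4 hg4, integral_const_mul,
          integral_const_mul, integral_const_mul, hfg, mul_zero, add_zero]

theorem integral_pow_four_sum_le {κ : Type*} {f : κ → Ω → ℝ} (hf : ∀ j, MemLp (f j) 4 μ) {M : ℝ}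
    (hM : ∀ j, ∫ x, f j x ^ 4 ∂μ ≤ M)
    (hzero : ∀ s : Finset κ, ∀ j ∉ s, ∫ x, (∑ i ∈ s, f i x) ^ 3 * f j x ∂μ = 0) (s : Finset κ) :
    ∫ x, (∑ j ∈ s, f j x) ^ 4 ∂μ ≤ 16 * (s.card : ℝ) ^ 2 * M := by
  classical
  induction s using Finset.induction_on with
  | empty => simp
  | insert j s hj ih =>
    have hM0 : 0 ≤ M := (integral_nonneg fun _ ↦ by positivity).trans (hM j)
    rw [Finset.card_insert_of_notMem hj]
    obtain rfl | hs := s.eq_empty_or_nonempty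
    · simpa using (hM j).trans (by linarith)
    have hk : (0 : ℝ) < s.card := by exact_mod_cast hs.card_pos
    calc ∫ x, (∑ i ∈ insert j s, f i x) ^ 4 ∂μ
        = ∫ x, (∑ i ∈ s, f i x + f j x) ^ 4 ∂μ := by simp_rw [Finset.sum_insert hj, add_comm]
      _ ≤ (1 + 1 / s.card) * ∫ x, (∑ i ∈ s, f i x) ^ 4 ∂μ +
            (16 * s.card + 3) * ∫ x, f j x ^ 4 ∂μ :=
          integral_pow_four_add_le (memLp_finsetSum _ fun i _ ↦ hf i) (hf j) (hzero s j hj) hk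
      _ ≤ (1 + 1 / s.card) * (16 * (s.card : ℝ) ^ 2 * M) + (16 * s.card + 3) * M := by
          gcongr
          exact hM j
      _ = (16 * (s.card : ℝ) ^ 2 + 32 * s.card + 3) * M := by
          field_simp
          ring
      _ ≤ 16 * ((s.card + 1 : ℕ) : ℝ) ^ 2 * M := by
          gcongr
          push_cast
          linarith

end FourthMoment

section QuadraticForm

variable {ι E : Type*} [Fintype ι]

/-- The part of `quadForm a h` that involves the coordinate `i`. -/
def linearPart (a : ι → ι → ℝ) (h : E → E → ℝ) (i : ι) (x : ι → E) : ℝ :=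
  ∑ j, a i j * h (x i) (x j)

/-- The weighted degenerate U-statistic `∑_{i < j} a_ij h(x_i, x_j)`, for symmetric weights `a`
vanishing on the diagonal. -/
noncomputable def quadForm (a : ι → ι → ℝ) (h : E → E → ℝ) (x : ι → E) : ℝ :=
  (∑ i, linearPart a h i x) / 2

/-- The conditional second moment of `linearPart a h i` given the coordinates other than `i`. -/
noncomputable def gramPart [MeasurableSpace E] (F : Measure E) (a : ι → ι → ℝ) (h : E → E → ℝ)
    (i : ι) (x : ι → E) : ℝ :=
  ∑ j, ∑ l, a i j * a i l * gram F h (x j) (x l)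

variable {h : E → E → ℝ} {a : ι → ι → ℝ} (ha : ∀ i, a i i = 0)

include ha in
theorem linearPart_update [DecidableEq ι] (i : ι) (x : ι → E) (z : E) :
    linearPart a h i (Function.update x i z) = ∑ j, a i j * h z (x j) := by
  refine Finset.sum_congr rfl fun j _ ↦ ?_
  obtain rfl | hji := eq_or_ne j i
  · rw [ha, zero_mul, zero_mul]
  · rw [Function.update_self, Function.update_of_ne hji]

include ha in
theorem quadForm_sub_linearPart [DecidableEq ι] (hasymm : ∀ i j, a i j = a j i)
    (hsymm : ∀ x y, h x y = h y x) (i : ι) (x : ι → E) :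
    quadForm a h x - linearPart a h i x =
      (∑ j ∈ {i}ᶜ, ∑ l ∈ {i}ᶜ, a j l * h (x j) (x l)) / 2 := by
  have hcol : ∑ j ∈ {i}ᶜ, a j i * h (x j) (x i) = linearPart a h i x := by
    rw [linearPart, Fintype.sum_eq_add_sum_compl i, ha, zero_mul, zero_add]
    exact Finset.sum_congr rfl fun j _ ↦ by rw [hasymm j i, hsymm]
  have hrow (j : ι) : linearPart a h j x =
      a j i * h (x j) (x i) + ∑ l ∈ {i}ᶜ, a j l * h (x j) (x l) :=
    Fintype.sum_eq_add_sum_compl i _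
  rw [quadForm, Fintype.sum_eq_add_sum_compl i, Finset.sum_congr rfl fun j _ ↦ hrow j,
    Finset.sum_add_distrib, hcol]
  ring

include ha in
theorem quadForm_sub_linearPart_update [DecidableEq ι] (hasymm : ∀ i j, a i j = a j i)
    (hsymm : ∀ x y, h x y = h y x) (i : ι) (x : ι → E) (z : E) :
    quadForm a h (Function.update x i z) - linearPart a h i (Function.update x i z) =
      quadForm a h x - linearPart a h i x := by
  rw [quadForm_sub_linearPart ha hasymm hsymm, quadForm_sub_linearPart ha hasymm hsymm]
  congr 1
  refine Finset.sum_congr rfl fun j hj ↦ Finset.sum_congr rfl fun l hl ↦ ?_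
  rw [Function.update_of_ne (by simpa using hj), Function.update_of_ne (by simpa using hl)]

variable [MeasurableSpace E] {F : Measure E} [IsProbabilityMeasure F] (hh : IsDegenerateKernel F h)
include hh

section Weights
include ha

theorem memLp_weight_mul_kernel (i j : ι) :
    MemLp (fun x : ι → E ↦ a i j * h (x i) (x j)) 4 (iidLaw ι F) := by
  obtain rfl | hij := eq_or_ne i j
  · simp [ha]
  · exact (memLp_pair hh.memLp hij).const_mul _

theorem memLp_linearPart (i : ι) : MemLp (linearPart a h i) 4 (iidLaw ι F) :=
  memLp_finsetSum _ fun j _ ↦ memLp_weight_mul_kernel ha hh i j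

theorem memLp_quadForm : MemLp (quadForm a h) 4 (iidLaw ι F) := by
  have hdef : quadForm a h = fun x : ι → E ↦ 2⁻¹ * ∑ i, linearPart a h i x := by
    ext x
    rw [quadForm, div_eq_inv_mul]
  rw [hdef]
  exact (memLp_finsetSum _ fun i _ ↦ memLp_linearPart ha hh i).const_mul _

theorem integral_linearPart_sq_le (i : ι) :
    ∫ x, linearPart a h i x ^ 2 ∂iidLaw ι F ≤
      2 * ((∑ j, a i j ^ 2) * ∫ z, h z.1 z.2 ^ 2 ∂F.prod F) := by
  classical
  have hrow := integral_sq_sum_pair_le hh.symm (memLp_two_of_four hh.memLp) hh.integral_eq_zero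
    (c := fun r j ↦ if r = i then a i j else 0) (fun r ↦ by split_ifs with hr <;> simp [hr, ha])
  simpa [ite_mul, ite_pow, linearPart] using hrow

theorem integral_quadForm_sq_le :
    ∫ x, quadForm a h x ^ 2 ∂iidLaw ι F ≤
      (∑ i, ∑ j, a i j ^ 2) / 2 * ∫ z, h z.1 z.2 ^ 2 ∂F.prod F := by
  have hle := integral_sq_sum_pair_le hh.symm (memLp_two_of_four hh.memLp) hh.integral_eq_zero ha
  simp_rw [quadForm, linearPart, div_pow, integral_div]
  linarith

theorem integral_linearPart_pow_four_le {B : ℝ} (hB : ∀ i j, |a i j| ≤ B) (i : ι) :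
    ∫ x, linearPart a h i x ^ 4 ∂iidLaw ι F ≤
      16 * (Fintype.card ι : ℝ) ^ 2 * (B ^ 4 * ∫ z, h z.1 z.2 ^ 4 ∂F.prod F) := by
  classical
  refine integral_pow_four_sum_le (memLp_weight_mul_kernel ha hh i) (fun j ↦ ?_)
    (fun s j hj ↦ ?_) Finset.univ
  · obtain rfl | hij := eq_or_ne i j
    · simp only [ha, zero_mul, ne_eq, OfNat.ofNat_ne_zero, not_false_eq_true, zero_pow,
        integral_zero]
      positivity
    · simp_rw [mul_pow]
      rw [integral_const_mul, integral_pair (k := fun x y ↦ h x y ^ 4)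
        (hh.memLp.aestronglyMeasurable.fun_pow 4) hij, ← Even.pow_abs ⟨2, rfl⟩]
      gcongr
      exact hB i j
  · obtain rfl | hij := eq_or_ne i j
    · simp [ha]
    have hsum : MemLp (fun x ↦ ∑ l ∈ s, a i l * h (x i) (x l)) 4 (iidLaw ι F) :=
      memLp_finsetSum _ fun l _ ↦ memLp_weight_mul_kernel ha hh i l
    have hint : Integrable (fun x ↦ (∑ l ∈ s, a i l * h (x i) (x l)) ^ 3 *
        (a i j * h (x i) (x j))) (iidLaw ι F) := by
      refine ((memLp_two_mul hsum hsum).integrable_mul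
        (memLp_two_mul hsum (memLp_weight_mul_kernel ha hh i j))).congr (ae_of_all _ fun x ↦ ?_)
      simp only [Pi.mul_apply]
      ring
    refine integral_mul_eq_zero_of_update j hint (fun x z ↦ ?_) fun x ↦ ?_
    · congr 1
      refine Finset.sum_congr rfl fun l hl ↦ ?_
      rw [Function.update_of_ne hij, Function.update_of_ne (ne_of_mem_of_not_mem hl hj)]
    · simp_rw [Function.update_self, Function.update_of_ne hij, integral_const_mul,
        hh.integral_eq_zero, mul_zero]

end Weights

section ConditionalMoments
variable [DecidableEq ι]
include ha

omit [IsProbabilityMeasure F] in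
theorem memLp_linearPart_update (i : ι) (x : ι → E) :
    MemLp (fun z ↦ linearPart a h i (Function.update x i z)) 4 F := by
  simp_rw [linearPart_update ha, hh.symm _ (x _)]
  exact memLp_finsetSum _ fun j _ ↦ (hh.memLp_right _).const_mul _

theorem integral_linearPart_update (i : ι) (x : ι → E) :
    ∫ z, linearPart a h i (Function.update x i z) ∂F = 0 := by
  simp_rw [linearPart_update ha, hh.symm _ (x _)]
  rw [integral_finsetSum _ fun j _ ↦
    ((memLp_two_of_four (hh.memLp_right _)).integrable one_le_two).const_mul _]
  simp_rw [integral_const_mul, hh.integral_eq_zero, mul_zero, Finset.sum_const_zero]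

theorem integral_linearPart_update_sq (i : ι) (x : ι → E) :
    ∫ z, linearPart a h i (Function.update x i z) ^ 2 ∂F = gramPart F a h i x := by
  have hint (j l : ι) : Integrable (fun z ↦ a i j * a i l * (h (x j) z * h (x l) z)) F :=
    ((memLp_two_of_four (hh.memLp_right _)).integrable_mul
      (memLp_two_of_four (hh.memLp_right _))).const_mul _
  simp_rw [linearPart_update ha, sq, Finset.sum_mul_sum, gramPart, hh.symm _ (x _),
    mul_mul_mul_comm]
  rw [integral_finsetSum _ fun j _ ↦ integrable_finsetSum _ fun l _ ↦ hint j l]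
  refine Finset.sum_congr rfl fun j _ ↦ ?_
  rw [integral_finsetSum _ fun l _ ↦ hint j l]
  simp_rw [integral_const_mul, gram]

end ConditionalMoments

theorem memLp_gram_eval (j l : ι) :
    MemLp (fun x ↦ gram F h (x j) (x l)) 2 (iidLaw ι F) := by
  obtain rfl | hjl := eq_or_ne j l
  · exact memLp_eval hh.memLp_gram_diag j
  · exact memLp_pair hh.memLp_gram hjl

theorem memLp_gramPart (i : ι) : MemLp (gramPart F a h i) 2 (iidLaw ι F) :=
  memLp_finsetSum _ fun j _ ↦ memLp_finsetSum _ fun l _ ↦ (memLp_gram_eval hh j l).const_mul _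

include ha in
theorem integral_gramPart_sq_le (i : ι) :
    ∫ x, gramPart F a h i x ^ 2 ∂iidLaw ι F ≤ ∫ x, linearPart a h i x ^ 4 ∂iidLaw ι F := by
  classical
  have hL4 := (memLp_four_iff (memLp_linearPart ha hh i).aestronglyMeasurable).1
    (memLp_linearPart ha hh i)
  rw [integral_update hL4 i]
  refine integral_mono (memLp_gramPart hh i).integrable_sq
    ((measurePreserving_update (fun _ ↦ F) i).integrable_comp_of_integrable hL4).integral_prod_left
    fun x ↦ ?_
  have hL := memLp_linearPart_update ha hh i x
  calc gramPart F a h i x ^ 2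
      = (∫ z, linearPart a h i (Function.update x i z) * linearPart a h i (Function.update x i z)
          ∂F) ^ 2 := by simp_rw [← integral_linearPart_update_sq ha hh, sq]
    _ ≤ _ := sq_integral_le_integral_sq (memLp_two_mul hL hL)
    _ = ∫ z, linearPart a h i (Function.update x i z) ^ 4 ∂F := by ring_nf

end QuadraticForm

section GramPart

variable {ι E : Type*} [Fintype ι] [MeasurableSpace E] {F : Measure E} {h : E → E → ℝ}
  {a : ι → ι → ℝ}

theorem sum_mul_sq_le {B : ℝ} (hB : ∀ i j, |a i j| ≤ B) (j l : ι) :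
    (∑ i, a i j * a i l) ^ 2 ≤ (Fintype.card ι : ℝ) ^ 2 * B ^ 4 := by
  have habs : |∑ i, a i j * a i l| ≤ Fintype.card ι * B ^ 2 :=
    calc |∑ i, a i j * a i l| ≤ ∑ i, |a i j * a i l| := Finset.abs_sum_le_sum_abs _ _
      _ ≤ ∑ _i : ι, B ^ 2 := Finset.sum_le_sum fun i _ ↦ by
          rw [abs_mul, sq]
          exact mul_le_mul (hB i j) (hB i l) (abs_nonneg _) ((abs_nonneg _).trans (hB i j))
      _ = Fintype.card ι * B ^ 2 := by simp
  calc (∑ i, a i j * a i l) ^ 2 = |∑ i, a i j * a i l| ^ 2 := (sq_abs _).symm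
    _ ≤ (Fintype.card ι * B ^ 2) ^ 2 := by gcongr
    _ = _ := by ring

theorem sum_gramPart_sub [DecidableEq ι] (τ : ℝ) (x : ι → E) :
    ∑ i, gramPart F a h i x - (∑ i, ∑ j, a i j ^ 2) * τ =
      ∑ j, (∑ i, a i j * a i j) * (gram F h (x j) (x j) - τ) +
        ∑ j, ∑ l, (if j = l then 0 else ∑ i, a i j * a i l) * gram F h (x j) (x l) := by
  have hsum : ∑ i, gramPart F a h i x =
      ∑ j, ∑ l, (∑ i, a i j * a i l) * gram F h (x j) (x l) := by
    simp_rw [gramPart, Finset.sum_mul]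
    rw [Finset.sum_comm]
    exact Finset.sum_congr rfl fun j _ ↦ Finset.sum_comm
  have hsplit (j l : ι) : (∑ i, a i j * a i l) * gram F h (x j) (x l) =
      (if j = l then (∑ i, a i j * a i j) * gram F h (x j) (x j) else 0) +
        (if j = l then 0 else ∑ i, a i j * a i l) * gram F h (x j) (x l) := by
    split_ifs with hjl
    · rw [← hjl, zero_mul, add_zero]
    · rw [zero_add]
  rw [hsum, Finset.sum_congr rfl fun j _ ↦ Finset.sum_congr rfl fun l _ ↦ hsplit j l]
  simp_rw [Finset.sum_add_distrib, Finset.sum_ite_eq, Finset.mem_univ, if_true,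
    mul_sub, Finset.sum_sub_distrib, ← Finset.sum_mul, ← sq]
  rw [Finset.sum_comm (f := fun i j ↦ a i j ^ 2)]
  ring

variable [IsProbabilityMeasure F] (hh : IsDegenerateKernel F h) {B : ℝ}
  (hB : ∀ i j, |a i j| ≤ B)
include hh

theorem integral_gram_diag_sub_sq_le :
    ∫ z, (gram F h z z - ∫ q, h q.1 q.2 ^ 2 ∂F.prod F) ^ 2 ∂F ≤ ∫ q, h q.1 q.2 ^ 4 ∂F.prod F := by
  refine le_trans ?_ hh.integral_gram_diag_sq_le
  rw [← hh.integral_gram_diag]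
  exact (variance_eq_integral hh.memLp_gram_diag.aemeasurable).symm.trans_le
    (variance_le_expectation_sq hh.memLp_gram_diag.aestronglyMeasurable)

include hB

theorem integral_sum_gram_diag_sq_le :
    ∫ x, (∑ j, (∑ i, a i j * a i j) * (gram F h (x j) (x j) - ∫ q, h q.1 q.2 ^ 2 ∂F.prod F)) ^ 2
        ∂iidLaw ι F ≤
      (Fintype.card ι : ℝ) ^ 3 * B ^ 4 * ∫ z, h z.1 z.2 ^ 4 ∂F.prod F := by
  have hcent : ∫ z, (gram F h z z - ∫ q, h q.1 q.2 ^ 2 ∂F.prod F) ∂F = 0 := by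
    rw [integral_sub (hh.memLp_gram_diag.integrable one_le_two) (integrable_const _),
      hh.integral_gram_diag, integral_const, probReal_univ, one_smul, sub_self]
  calc _ ≤ (∑ j, (∑ i, a i j * a i j) ^ 2) *
          ∫ z, (gram F h z z - ∫ q, h q.1 q.2 ^ 2 ∂F.prod F) ^ 2 ∂F :=
        integral_sq_sum_eval_le (hh.memLp_gram_diag.sub (memLp_const _)) hcent _
    _ ≤ (∑ _j : ι, (Fintype.card ι : ℝ) ^ 2 * B ^ 4) * ∫ z, h z.1 z.2 ^ 4 ∂F.prod F := by
        gcongr with j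
        · exact sum_mul_sq_le hB j j
        · exact integral_gram_diag_sub_sq_le hh
    _ = _ := by
        rw [Finset.sum_const, Finset.card_univ, nsmul_eq_mul]
        ring

theorem integral_sum_gram_offDiag_sq_le [DecidableEq ι] :
    ∫ x, (∑ j, ∑ l, (if j = l then 0 else ∑ i, a i j * a i l) * gram F h (x j) (x l)) ^ 2
        ∂iidLaw ι F ≤
      2 * ((Fintype.card ι : ℝ) ^ 4 * B ^ 4 * ∫ z, gram F h z.1 z.2 ^ 2 ∂F.prod F) := by
  calc _ ≤ 2 * ((∑ j, ∑ l, (if j = l then 0 else ∑ i, a i j * a i l) ^ 2) *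
          ∫ z, gram F h z.1 z.2 ^ 2 ∂F.prod F) :=
        integral_sq_sum_pair_le (gram_comm F h) hh.memLp_gram hh.integral_gram_eq_zero
          fun i ↦ if_pos rfl
    _ ≤ 2 * ((∑ _j : ι, ∑ _l : ι, (Fintype.card ι : ℝ) ^ 2 * B ^ 4) *
          ∫ z, gram F h z.1 z.2 ^ 2 ∂F.prod F) := by
        gcongr with j _ l
        split_ifs
        · rw [zero_pow two_ne_zero]
          positivity
        · exact sum_mul_sq_le hB j l
    _ = _ := by
        simp only [Finset.sum_const, Finset.card_univ, nsmul_eq_mul]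
        ring

theorem integral_sum_gramPart_sub_sq_le :
    ∫ x, (∑ i, gramPart F a h i x - (∑ i, ∑ j, a i j ^ 2) * ∫ z, h z.1 z.2 ^ 2 ∂F.prod F) ^ 2
        ∂iidLaw ι F ≤
      2 * ((Fintype.card ι : ℝ) ^ 3 * B ^ 4 * ∫ z, h z.1 z.2 ^ 4 ∂F.prod F) +
        4 * ((Fintype.card ι : ℝ) ^ 4 * B ^ 4 * ∫ z, gram F h z.1 z.2 ^ 2 ∂F.prod F) := by
  classical
  set D : (ι → E) → ℝ := fun x ↦
    ∑ j, (∑ i, a i j * a i j) * (gram F h (x j) (x j) - ∫ q, h q.1 q.2 ^ 2 ∂F.prod F)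
  set O : (ι → E) → ℝ := fun x ↦
    ∑ j, ∑ l, (if j = l then 0 else ∑ i, a i j * a i l) * gram F h (x j) (x l)
  have hD2 : MemLp D 2 (iidLaw ι F) := memLp_finsetSum _ fun j _ ↦
    ((memLp_gram_eval hh j j).sub (memLp_const _)).const_mul _
  have hO2 : MemLp O 2 (iidLaw ι F) := memLp_finsetSum _ fun j _ ↦
    memLp_finsetSum _ fun l _ ↦ (memLp_gram_eval hh j l).const_mul _
  have hDi := hD2.integrable_sq.const_mul 2
  have hOi := hO2.integrable_sq.const_mul 2
  simp_rw [sum_gramPart_sub]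
  calc ∫ x, (D x + O x) ^ 2 ∂iidLaw ι F ≤ ∫ x, (2 * D x ^ 2 + 2 * O x ^ 2) ∂iidLaw ι F := by
        refine integral_mono (hD2.add hO2).integrable_sq (hDi.add hOi) fun x ↦ ?_
        simpa only [mul_add] using add_sq_le (a := D x) (b := O x)
    _ = 2 * ∫ x, D x ^ 2 ∂iidLaw ι F + 2 * ∫ x, O x ^ 2 ∂iidLaw ι F := by
        rw [integral_add hDi hOi, integral_const_mul, integral_const_mul]
    _ ≤ _ := by
        linarith [integral_sum_gram_diag_sq_le hh hB, integral_sum_gram_offDiag_sq_le hh hB]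

end GramPart

section QuantitativeCLT

variable {ι E : Type*} [Fintype ι] [MeasurableSpace E] {F : Measure E} [IsProbabilityMeasure F]
  {h : E → E → ℝ} {a : ι → ι → ℝ} (ha : ∀ i, a i i = 0) (hasymm : ∀ i j, a i j = a j i)
  (hh : IsDegenerateKernel F h)
include ha hasymm hh

theorem norm_integral_circleExp_linearPart_sub_le (t : ℝ) (i : ι) :
    ‖∫ x, (Circle.exp (t * quadForm a h x) : ℂ) * (linearPart a h i x : ℂ) ∂iidLaw ι F -
        t * Complex.I * ∫ x, (Circle.exp (t * quadForm a h x) : ℂ) * (gramPart F a h i x : ℂ)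
          ∂iidLaw ι F‖ ≤
      3 * t ^ 2 * √((∫ x, linearPart a h i x ^ 2 ∂iidLaw ι F) *
        ∫ x, linearPart a h i x ^ 4 ∂iidLaw ι F) := by
  classical
  set R : (ι → E) → ℝ := fun x ↦ quadForm a h x - linearPart a h i x with hR
  have hL := memLp_linearPart (a := a) ha hh i
  have hRm : AEStronglyMeasurable R (iidLaw ι F) :=
    ((memLp_quadForm ha hh).sub hL).aestronglyMeasurable
  have hRinv (x : ι → E) (z : E) : R (Function.update x i z) = R x :=
    quadForm_sub_linearPart_update ha hasymm hh.symm i x z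
  have hcent : ∫ x, (Circle.exp (t * R x) : ℂ) * (linearPart a h i x : ℂ) ∂iidLaw ι F = 0 := by
    refine integral_mul_eq_zero_of_update i (integrable_circleExp_mul (hRm.const_mul t)
      ((memLp_two_of_four hL).integrable one_le_two)) (fun x z ↦ by rw [hRinv]) fun x ↦ ?_
    rw [integral_complex_ofReal, integral_linearPart_update ha hh, Complex.ofReal_zero]
  have hcond : ∫ x, (Circle.exp (t * R x) : ℂ) * ((linearPart a h i x ^ 2 : ℝ) : ℂ) ∂iidLaw ι F =
      ∫ x, (Circle.exp (t * R x) : ℂ) * (gramPart F a h i x : ℂ) ∂iidLaw ι F := by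
    rw [integral_update (integrable_circleExp_mul (hRm.const_mul t)
      (memLp_two_of_four hL).integrable_sq) i]
    simp_rw [hRinv, integral_const_mul, integral_complex_ofReal,
      integral_linearPart_update_sq ha hh]
  simpa only [hR, sub_add_cancel] using norm_integral_circleExp_mul_sub_le t hL
    (memLp_gramPart hh i) hRm hcent hcond (integral_gramPart_sq_le ha hh i)

omit hasymm in
theorem integral_circleExp_mul_quadForm {R : (ι → E) → ℝ}
    (hR : AEStronglyMeasurable R (iidLaw ι F)) :
    ∫ x, (Circle.exp (R x) : ℂ) * (quadForm a h x : ℂ) ∂iidLaw ι F =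
      2⁻¹ * ∑ i, ∫ x, (Circle.exp (R x) : ℂ) * (linearPart a h i x : ℂ) ∂iidLaw ι F := by
  rw [← integral_finsetSum _ fun i _ ↦ integrable_circleExp_mul hR
    ((memLp_two_of_four (memLp_linearPart ha hh i)).integrable one_le_two), ← integral_const_mul]
  refine integral_congr_ae (ae_of_all _ fun x ↦ ?_)
  simp only [← Finset.mul_sum, ← Complex.ofReal_sum]
  rw [show ∑ i, linearPart a h i x = 2 * quadForm a h x by rw [quadForm]; ring]
  push_cast
  ring

omit ha hasymm in
theorem integral_circleExp_mul_two {R : (ι → E) → ℝ}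
    (hR : AEStronglyMeasurable R (iidLaw ι F)) :
    (∫ x, (Circle.exp (R x) : ℂ) ∂iidLaw ι F) * 2 =
      ∑ i, ∫ x, (Circle.exp (R x) : ℂ) * (gramPart F a h i x : ℂ) ∂iidLaw ι F -
        ∫ x, (Circle.exp (R x) : ℂ) * ((∑ i, gramPart F a h i x - 2 : ℝ) : ℂ) ∂iidLaw ι F := by
  have hΓ (i : ι) : Integrable (gramPart F a h i) (iidLaw ι F) :=
    (memLp_gramPart hh i).integrable one_le_two
  have hW : Integrable (fun x ↦ ∑ i, gramPart F a h i x - 2) (iidLaw ι F) :=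
    (integrable_finsetSum _ fun i _ ↦ hΓ i).sub (integrable_const 2)
  have hRΓ (i : ι) := integrable_circleExp_mul hR (hΓ i)
  rw [← integral_finsetSum _ fun i _ ↦ hRΓ i, ← integral_sub
    (integrable_finsetSum _ fun i _ ↦ hRΓ i) (integrable_circleExp_mul hR hW),
    ← integral_mul_const]
  refine integral_congr_ae (ae_of_all _ fun x ↦ ?_)
  simp only [← Finset.mul_sum, ← Complex.ofReal_sum, ← mul_sub, ← Complex.ofReal_sub,
    sub_sub_cancel, Complex.ofReal_ofNat]

theorem norm_integral_circleExp_quadForm_sub_le (t : ℝ) :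
    ‖∫ x, (Circle.exp (t * quadForm a h x) : ℂ) * (quadForm a h x : ℂ) ∂iidLaw ι F -
        t * Complex.I * ∫ x, (Circle.exp (t * quadForm a h x) : ℂ) ∂iidLaw ι F‖ ≤
      3 / 2 * t ^ 2 * ∑ i, √((∫ x, linearPart a h i x ^ 2 ∂iidLaw ι F) *
          ∫ x, linearPart a h i x ^ 4 ∂iidLaw ι F) +
        |t| / 2 * ∫ x, |∑ i, gramPart F a h i x - 2| ∂iidLaw ι F := by
  have hS : AEStronglyMeasurable (fun x ↦ t * quadForm a h x) (iidLaw ι F) :=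
    (memLp_quadForm ha hh).aestronglyMeasurable.const_mul t
  have hW : Integrable (fun x ↦ ∑ i, gramPart F a h i x - 2) (iidLaw ι F) :=
    (integrable_finsetSum _ fun i _ ↦ (memLp_gramPart hh i).integrable one_le_two).sub
      (integrable_const _)
  set X : ι → ℂ := fun i ↦
    ∫ x, (Circle.exp (t * quadForm a h x) : ℂ) * (linearPart a h i x : ℂ) ∂iidLaw ι F
  set Y : ι → ℂ := fun i ↦
    ∫ x, (Circle.exp (t * quadForm a h x) : ℂ) * (gramPart F a h i x : ℂ) ∂iidLaw ι F
  set Z : ℂ := ∫ x, (Circle.exp (t * quadForm a h x) : ℂ) *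
    ((∑ i, gramPart F a h i x - 2 : ℝ) : ℂ) ∂iidLaw ι F
  have hZle : ‖Z‖ ≤ ∫ x, |∑ i, gramPart F a h i x - 2| ∂iidLaw ι F :=
    norm_integral_le_of_norm_le hW.abs (ae_of_all _ fun x ↦ by
      rw [norm_mul, Circle.norm_coe, one_mul, Complex.norm_real, Real.norm_eq_abs])
  have hsplit : ∫ x, (Circle.exp (t * quadForm a h x) : ℂ) * (quadForm a h x : ℂ) ∂iidLaw ι F -
      t * Complex.I * ∫ x, (Circle.exp (t * quadForm a h x) : ℂ) ∂iidLaw ι F =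
      2⁻¹ * (∑ i, (X i - t * Complex.I * Y i) + t * Complex.I * Z) := by
    rw [integral_circleExp_mul_quadForm ha hh hS, Finset.sum_sub_distrib, ← Finset.mul_sum]
    linear_combination (-(t : ℂ) * Complex.I / 2) * integral_circleExp_mul_two (a := a) hh hS
  calc _ ≤ 2⁻¹ * (∑ i, 3 * t ^ 2 * √((∫ x, linearPart a h i x ^ 2 ∂iidLaw ι F) *
          ∫ x, linearPart a h i x ^ 4 ∂iidLaw ι F) +
        |t| * ∫ x, |∑ i, gramPart F a h i x - 2| ∂iidLaw ι F) := by
        rw [hsplit, norm_mul, norm_inv, Complex.norm_ofNat]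
        gcongr
        refine (norm_add_le _ _).trans (add_le_add (norm_sum_le_of_le _ fun i _ ↦
          norm_integral_circleExp_linearPart_sub_le ha hasymm hh t i) ?_)
        rw [norm_mul, norm_mul, Complex.norm_I, mul_one, Complex.norm_real, Real.norm_eq_abs]
        gcongr
    _ = _ := by
        rw [← Finset.mul_sum]
        ring

omit hasymm in
theorem sum_sqrt_linearPart_moments_le {B : ℝ} (hB : ∀ i j, |a i j| ≤ B)
    (hnorm : (∑ i, ∑ j, a i j ^ 2) * ∫ z, h z.1 z.2 ^ 2 ∂F.prod F = 2) :
    ∑ i, √((∫ x, linearPart a h i x ^ 2 ∂iidLaw ι F) *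
        ∫ x, linearPart a h i x ^ 4 ∂iidLaw ι F) ≤
      8 * √((Fintype.card ι : ℝ) ^ 3 * B ^ 4 * ∫ z, h z.1 z.2 ^ 4 ∂F.prod F) := by
  have hpos2 (i : ι) : 0 ≤ ∫ x, linearPart a h i x ^ 2 ∂iidLaw ι F :=
    integral_nonneg fun _ ↦ by positivity
  have hpos4 (i : ι) : 0 ≤ ∫ x, linearPart a h i x ^ 4 ∂iidLaw ι F :=
    integral_nonneg fun _ ↦ by positivity
  have hsum2 : ∑ i, ∫ x, linearPart a h i x ^ 2 ∂iidLaw ι F ≤ 4 :=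
    (Finset.sum_le_sum fun i _ ↦ integral_linearPart_sq_le ha hh i).trans (by
      rw [← Finset.mul_sum, ← Finset.sum_mul]
      linarith)
  have hsum4 : ∑ i, ∫ x, linearPart a h i x ^ 4 ∂iidLaw ι F ≤
      16 * ((Fintype.card ι : ℝ) ^ 3 * B ^ 4 * ∫ z, h z.1 z.2 ^ 4 ∂F.prod F) :=
    (Finset.sum_le_sum fun i _ ↦ integral_linearPart_pow_four_le ha hh hB i).trans_eq (by
      rw [Finset.sum_const, Finset.card_univ, nsmul_eq_mul]
      ring)
  simp_rw [Real.sqrt_mul (hpos2 _)]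
  calc _ ≤ √(∑ i, ∫ x, linearPart a h i x ^ 2 ∂iidLaw ι F) *
          √(∑ i, ∫ x, linearPart a h i x ^ 4 ∂iidLaw ι F) :=
        Real.sum_sqrt_mul_sqrt_le _ hpos2 hpos4
    _ ≤ √(2 ^ 2) *
          √(4 ^ 2 * ((Fintype.card ι : ℝ) ^ 3 * B ^ 4 * ∫ z, h z.1 z.2 ^ 4 ∂F.prod F)) := by
        gcongr
        · linarith
        · linarith
    _ = _ := by
        rw [Real.sqrt_mul (by positivity), Real.sqrt_sq two_pos.le, Real.sqrt_sq (by norm_num)]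
        ring

theorem norm_charFun_quadForm_sub_charFun_gaussianReal_le {B : ℝ} (hB : ∀ i j, |a i j| ≤ B)
    (hnorm : (∑ i, ∑ j, a i j ^ 2) * ∫ z, h z.1 z.2 ^ 2 ∂F.prod F = 2) (t : ℝ) :
    ‖charFun ((iidLaw ι F).map (quadForm a h)) t - charFun (gaussianReal 0 1) t‖ ≤
      |t| * (12 * t ^ 2 * √((Fintype.card ι : ℝ) ^ 3 * B ^ 4 * ∫ z, h z.1 z.2 ^ 4 ∂F.prod F) +
        |t| * √((Fintype.card ι : ℝ) ^ 3 * B ^ 4 * ∫ z, h z.1 z.2 ^ 4 ∂F.prod F +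
          (Fintype.card ι : ℝ) ^ 4 * B ^ 4 * ∫ z, gram F h z.1 z.2 ^ 2 ∂F.prod F)) := by
  set u := (Fintype.card ι : ℝ) ^ 3 * B ^ 4 * ∫ z, h z.1 z.2 ^ 4 ∂F.prod F
  set v := (Fintype.card ι : ℝ) ^ 4 * B ^ 4 * ∫ z, gram F h z.1 z.2 ^ 2 ∂F.prod F
  have hQ := (memLp_quadForm ha hh (a := a))
  have hQm : AEMeasurable (quadForm a h) (iidLaw ι F) := hQ.aestronglyMeasurable.aemeasurable
  have := Measure.isProbabilityMeasure_map (μ := iidLaw ι F) hQm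
  have hW : ∫ x, |∑ i, gramPart F a h i x - 2| ∂iidLaw ι F ≤ 2 * √(u + v) := by
    have hWm : MemLp (fun x ↦ ∑ i, gramPart F a h i x - 2) 2 (iidLaw ι F) :=
      (memLp_finsetSum _ fun i _ ↦ memLp_gramPart hh i).sub (memLp_const 2)
    have hle := integral_sum_gramPart_sub_sq_le hh hB
    rw [hnorm] at hle
    have hu0 : 0 ≤ u := by positivity
    calc _ ≤ √(2 ^ 2 * (u + v)) :=
          (integral_abs_le_sqrt hWm).trans (Real.sqrt_le_sqrt (by linarith))
      _ = 2 * √(u + v) := by rw [Real.sqrt_mul (by positivity), Real.sqrt_sq two_pos.le]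
  refine norm_charFun_sub_charFun_gaussianReal_le ((memLp_map_measure_iff
    aestronglyMeasurable_id hQm).2 (hQ.mono_exponent (by norm_num))) t fun s hs ↦ ?_
  rw [charFun_map_real hQm, integral_map hQm (by fun_prop)]
  have hst : s ^ 2 ≤ t ^ 2 := sq_le_sq.2 hs
  calc _ ≤ 3 / 2 * s ^ 2 * (8 * √u) + |s| / 2 * (2 * √(u + v)) :=
        (norm_integral_circleExp_quadForm_sub_le ha hasymm hh s).trans (by
          gcongr
          exact sum_sqrt_linearPart_moments_le ha hh hB hnorm)
    _ ≤ 3 / 2 * t ^ 2 * (8 * √u) + |t| / 2 * (2 * √(u + v)) := by gcongr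
    _ = _ := by ring

end QuantitativeCLT

section CenteredDist

variable {p : ℕ} {F : Measure (Eucl p)}

theorem doubleCenteredDist_eq (x y : Eucl p) :
    doubleCenteredDist F x y =
      ‖x - y‖ - ((∫ z, ‖x - z‖ ∂F) + (∫ z, ‖y - z‖ ∂F) - ∫ z, ‖z.1 - z.2‖ ∂F.prod F) := by
  simp_rw [doubleCenteredDist, norm_sub_rev _ y]
  ring

theorem integrable_norm_of_norm_pow_four [IsFiniteMeasure F]
    (hF : Integrable (fun x ↦ ‖x‖ ^ 4) F) : Integrable (fun x ↦ ‖x‖) F :=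
  ((memLp_four_iff (by fun_prop)).2 hF).integrable (by norm_num)

theorem integrable_norm_sub [IsFiniteMeasure F] (hF : Integrable (fun x ↦ ‖x‖) F) (x : Eucl p) :
    Integrable (fun z ↦ ‖x - z‖) F :=
  ((integrable_const ‖x‖).add hF).mono' (by fun_prop)
    (ae_of_all _ fun z ↦ by simpa using norm_sub_le x z)

variable [IsProbabilityMeasure F]

theorem integrable_norm_sub_prod (hF : Integrable (fun x ↦ ‖x‖) F) :
    Integrable (fun z : Eucl p × Eucl p ↦ ‖z.1 - z.2‖) (F.prod F) :=
  ((hF.comp_fst F).add (hF.comp_snd F)).mono' (by fun_prop)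
    (ae_of_all _ fun z ↦ by simpa using norm_sub_le z.1 z.2)

theorem measurable_doubleCenteredDist : Measurable (Function.uncurry (doubleCenteredDist F)) := by
  have hdist : StronglyMeasurable fun q : Eucl p × Eucl p ↦ ‖q.1 - q.2‖ :=
    Continuous.stronglyMeasurable (by fun_prop)
  have hmean : Measurable fun x : Eucl p ↦ ∫ z, ‖x - z‖ ∂F :=
    hdist.integral_prod_right'.measurable
  rw [show Function.uncurry (doubleCenteredDist F) = _ from
    funext fun q ↦ doubleCenteredDist_eq q.1 q.2]
  exact hdist.measurable.sub
    (((hmean.comp measurable_fst).add (hmean.comp measurable_snd)).sub_const _)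

theorem integral_norm_sub_le (hF : Integrable (fun x ↦ ‖x‖) F) (x : Eucl p) :
    ∫ z, ‖x - z‖ ∂F ≤ ‖x‖ + ∫ z, ‖z‖ ∂F :=
  calc _ ≤ ∫ z, (‖x‖ + ‖z‖) ∂F := integral_mono (integrable_norm_sub hF x)
        ((integrable_const _).add hF) fun z ↦ norm_sub_le x z
    _ = _ := by
        rw [integral_add (integrable_const _) hF, integral_const, probReal_univ, one_smul]

theorem integral_norm_sub_prod_le (hF : Integrable (fun x ↦ ‖x‖) F) :
    ∫ z, ‖z.1 - z.2‖ ∂F.prod F ≤ 2 * ∫ z, ‖z‖ ∂F := by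
  rw [integral_prod _ (integrable_norm_sub_prod hF)]
  calc _ ≤ ∫ x, (‖x‖ + ∫ z, ‖z‖ ∂F) ∂F :=
        integral_mono (integrable_norm_sub_prod hF).integral_prod_left
          (hF.add (integrable_const _)) (integral_norm_sub_le hF)
    _ = _ := by
        rw [integral_add hF (integrable_const _), integral_const, probReal_univ, one_smul, two_mul]

theorem abs_doubleCenteredDist_le (hF : Integrable (fun x ↦ ‖x‖) F) (x y : Eucl p) :
    |doubleCenteredDist F x y| ≤
      (1 + 2 * (∫ z, ‖z‖ ∂F) + 2 * ‖x‖) * (1 + 2 * (∫ z, ‖z‖ ∂F) + 2 * ‖y‖) := by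
  have hmean0 (x : Eucl p) : 0 ≤ ∫ z, ‖x - z‖ ∂F := integral_nonneg fun _ ↦ norm_nonneg _
  have hprod0 : 0 ≤ ∫ z, ‖z.1 - z.2‖ ∂F.prod F := integral_nonneg fun _ ↦ norm_nonneg _
  have : 0 ≤ ∫ z, ‖z‖ ∂F := integral_nonneg fun _ ↦ norm_nonneg _
  have hcross : 0 ≤ (2 * (∫ z, ‖z‖ ∂F) + 2 * ‖x‖) * (2 * (∫ z, ‖z‖ ∂F) + 2 * ‖y‖) := by
    positivity
  calc _ ≤ 1 + 4 * (∫ z, ‖z‖ ∂F) + 2 * ‖x‖ + 2 * ‖y‖ := by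
        rw [doubleCenteredDist_eq, abs_le]
        constructor <;>
          linarith [hmean0 x, hmean0 y, integral_norm_sub_le hF x, integral_norm_sub_le hF y,
            integral_norm_sub_prod_le hF, norm_sub_le x y, norm_nonneg (x - y), norm_nonneg x,
            norm_nonneg y]
    _ ≤ _ := by linarith

theorem integral_doubleCenteredDist (hF : Integrable (fun x ↦ ‖x‖) F) (x : Eucl p) :
    ∫ y, doubleCenteredDist F x y ∂F = 0 := by
  have hmean : Integrable (fun y ↦ ∫ z, ‖y - z‖ ∂F) F :=
    (integrable_norm_sub_prod hF).integral_prod_left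
  have hshift : Integrable (fun y ↦ (∫ z, ‖x - z‖ ∂F) + ∫ z, ‖y - z‖ ∂F) F :=
    (integrable_const _).add hmean
  simp_rw [doubleCenteredDist_eq, ← sub_add]
  have hdiff : Integrable
      (fun y ↦ ‖x - y‖ - ((∫ z, ‖x - z‖ ∂F) + ∫ z, ‖y - z‖ ∂F)) F :=
    (integrable_norm_sub hF x).sub hshift
  rw [integral_add hdiff (integrable_const _), integral_sub (integrable_norm_sub hF x) hshift,
    integral_add (integrable_const _) hmean, integral_prod _ (integrable_norm_sub_prod hF)]
  simp

theorem isDegenerateKernel_doubleCenteredDist (hF : Integrable (fun x ↦ ‖x‖ ^ 4) F) :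
    IsDegenerateKernel F (doubleCenteredDist F) where
  measurable := measurable_doubleCenteredDist
  symm x y := by
    rw [doubleCenteredDist_eq, doubleCenteredDist_eq, norm_sub_rev x y]
    ring
  exists_bound := by
    have hnorm : MemLp (fun x ↦ ‖x‖) 4 F := (memLp_four_iff (by fun_prop)).2 hF
    have hA (c : ℝ) : MemLp (fun x ↦ c + 2 * ‖x‖) 4 F := (memLp_const c).add (hnorm.const_mul 2)
    exact ⟨_, hA _, abs_doubleCenteredDist_le (integrable_norm_of_norm_pow_four hF)⟩
  integral_eq_zero := integral_doubleCenteredDist (integrable_norm_of_norm_pow_four hF)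

end CenteredDist

section CyclicMoment

theorem IsDegenerateKernel.integral_gram_sq {E : Type*} [MeasurableSpace E] {F : Measure E}
    [IsProbabilityMeasure F] {h : E → E → ℝ} (hh : IsDegenerateKernel F h) :
    ∫ z, gram F h z.1 z.2 ^ 2 ∂F.prod F =
      ∫ x : Fin 4 → E, h (x 0) (x 2) * h (x 1) (x 2) * h (x 0) (x 3) * h (x 1) (x 3)
        ∂iidLaw (Fin 4) F := by
  have hpair {i j : Fin 4} (hij : i ≠ j) :
      MemLp (fun x : Fin 4 → E ↦ h (x i) (x j)) 4 (iidLaw (Fin 4) F) := memLp_pair hh.memLp hij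
  have hprod {j : Fin 4} (h0 : 0 ≠ j) (h1 : 1 ≠ j) :
      MemLp (fun x : Fin 4 → E ↦ h (x 0) (x j) * h (x 1) (x j)) 2 (iidLaw (Fin 4) F) :=
    memLp_two_mul (hpair h0) (hpair h1)
  have hfirst : Integrable (fun x : Fin 4 → E ↦
      h (x 0) (x 3) * h (x 1) (x 3) * (h (x 0) (x 2) * h (x 1) (x 2))) (iidLaw (Fin 4) F) :=
    (hprod (by decide) (by decide)).integrable_mul (hprod (by decide) (by decide))
  have hsecond : Integrable (fun x : Fin 4 → E ↦
      h (x 0) (x 3) * h (x 1) (x 3) * gram F h (x 0) (x 1)) (iidLaw (Fin 4) F) :=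
    (hprod (by decide) (by decide)).integrable_mul (memLp_gram_eval hh 0 1)
  symm
  calc _ = ∫ x : Fin 4 → E, h (x 0) (x 3) * h (x 1) (x 3) * (h (x 0) (x 2) * h (x 1) (x 2))
          ∂iidLaw (Fin 4) F := integral_congr_ae (ae_of_all _ fun x ↦ by ring)
    _ = ∫ x : Fin 4 → E, h (x 0) (x 3) * h (x 1) (x 3) * gram F h (x 0) (x 1)
          ∂iidLaw (Fin 4) F := by
        rw [integral_update hfirst 2]
        simp [integral_const_mul, gram]
    _ = ∫ x : Fin 4 → E, gram F h (x 0) (x 1) ^ 2 ∂iidLaw (Fin 4) F := by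
        rw [integral_update hsecond 3]
        simp [integral_mul_const, gram, sq]
    _ = _ := integral_pair (k := fun x y ↦ gram F h x y ^ 2)
        (hh.measurable_gram.pow_const 2).aestronglyMeasurable (by decide)

end CyclicMoment

section UStatistic

variable {ι E : Type*} [Fintype ι] [MeasurableSpace E] {F : Measure E} [IsProbabilityMeasure F]
  {k : E → E → ℝ} (hk : MemLp (Function.uncurry k) 2 (F.prod F))
  (hcent : ∫ z, k z.1 z.2 ∂F.prod F = 0)
include hk hcent

theorem integral_pair_mul_pair_eq_zero_of_disjoint {i j i' j' : ι} (hij : i ≠ j) (hij' : i' ≠ j')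
    (hii' : i ≠ i') (hij'' : i ≠ j') (hji' : j ≠ i') (hjj' : j ≠ j') :
    ∫ x, k (x i) (x j) * k (x i') (x j') ∂iidLaw ι F = 0 := by
  have hindep : IndepFun (fun x : ι → E ↦ (x i, x j)) (fun x ↦ (x i', x j')) (iidLaw ι F) :=
    (iIndepFun_pi (X := fun (_ : ι) (z : E) ↦ z) fun _ ↦ aemeasurable_id).indepFun_prodMk_prodMk
      (fun _ ↦ measurable_pi_apply _) i j i' j' hii' hij'' hji' hjj'
  have hkm {i j : ι} (hij : i ≠ j) : AEStronglyMeasurable (Function.uncurry k)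
      ((iidLaw ι F).map fun x ↦ (x i, x j)) := by
    rw [(hasLaw_pair F hij).map_eq]
    exact hk.aestronglyMeasurable
  calc _ = (∫ x, k (x i) (x j) ∂iidLaw ι F) * ∫ x, k (x i') (x j') ∂iidLaw ι F :=
        hindep.integral_fun_comp_mul_comp (hasLaw_pair F hij).aemeasurable
          (hasLaw_pair F hij').aemeasurable (hkm hij) (hkm hij')
    _ = 0 := by rw [integral_pair hk.aestronglyMeasurable hij, hcent, zero_mul]

theorem ncard_integral_pair_mul_pair_ne_zero_le [DecidableEq ι] (q : ι × ι) :
    {r : ι × ι | ∫ x : ι → E, (if q.1 = q.2 then 0 else k (x q.1) (x q.2)) *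
      (if r.1 = r.2 then 0 else k (x r.1) (x r.2)) ∂iidLaw ι F ≠ 0}.ncard ≤
      4 * Fintype.card ι := by
  have hsub : {r : ι × ι | ∫ x : ι → E, (if q.1 = q.2 then 0 else k (x q.1) (x q.2)) *
      (if r.1 = r.2 then 0 else k (x r.1) (x r.2)) ∂iidLaw ι F ≠ 0} ⊆
      ((({q.1, q.2} : Finset ι) ×ˢ Finset.univ ∪ Finset.univ ×ˢ {q.1, q.2} :
        Finset (ι × ι)) : Set (ι × ι)) := by
    intro r hr
    contrapose! hr
    by_cases hq : q.1 = q.2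
    · simp [hq]
    by_cases hr' : r.1 = r.2
    · simp [hr']
    simp only [Finset.coe_union, Set.mem_union, Finset.mem_coe, Finset.mem_product,
      Finset.mem_insert, Finset.mem_singleton, Finset.mem_univ, and_true, true_and,
      not_or] at hr
    simpa [hq, hr'] using integral_pair_mul_pair_eq_zero_of_disjoint hk hcent hq hr'
      (Ne.symm hr.1.1) (Ne.symm hr.2.1) (Ne.symm hr.1.2) (Ne.symm hr.2.2)
  calc _ ≤ _ := Set.ncard_le_ncard hsub (Finset.finite_toSet _)
    _ ≤ Finset.card (({q.1, q.2} : Finset ι) ×ˢ (Finset.univ : Finset ι)) +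
        Finset.card ((Finset.univ : Finset ι) ×ˢ ({q.1, q.2} : Finset ι)) := by
      rw [Set.ncard_coe_finset]
      exact Finset.card_union_le _ _
    _ ≤ 2 * Fintype.card ι + Fintype.card ι * 2 := by
      rw [Finset.card_product, Finset.card_product, Finset.card_univ]
      gcongr <;> exact Finset.card_le_two
    _ = _ := by ring

theorem integral_sq_sum_pair_le_of_centered [DecidableEq ι] :
    ∫ x : ι → E, (∑ i, ∑ j, if i = j then 0 else k (x i) (x j)) ^ 2 ∂iidLaw ι F ≤
      4 * (Fintype.card ι : ℝ) ^ 3 * ∫ z, k z.1 z.2 ^ 2 ∂F.prod F := by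
  set f : ι × ι → (ι → E) → ℝ := fun q x ↦ if q.1 = q.2 then 0 else k (x q.1) (x q.2) with hf
  have hmem (q : ι × ι) : MemLp (f q) 2 (iidLaw ι F) := by
    by_cases hq : q.1 = q.2
    · simp [hf, hq]
    · simpa [hf, hq] using memLp_pair hk hq
  have hsq (q : ι × ι) : ∫ x, f q x ^ 2 ∂iidLaw ι F ≤ ∫ z, k z.1 z.2 ^ 2 ∂F.prod F := by
    by_cases hq : q.1 = q.2
    · simpa [hf, hq] using integral_nonneg fun z : E × E ↦ sq_nonneg (k z.1 z.2)
    · simpa [hf, hq] using (integral_pair (k := fun x y ↦ k x y ^ 2)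
        (hk.aestronglyMeasurable.fun_pow 2) hq).le
  calc _ = ∫ x, (∑ q, f q x) ^ 2 ∂iidLaw ι F := by simp_rw [Fintype.sum_prod_type, hf]
    _ ≤ (4 * Fintype.card ι : ℕ) * ∑ q, ∫ x, f q x ^ 2 ∂iidLaw ι F :=
        integral_sq_sum_le_of_ncard hmem (ncard_integral_pair_mul_pair_ne_zero_le hk hcent)
    _ ≤ (4 * Fintype.card ι : ℕ) * ∑ _q : ι × ι, ∫ z, k z.1 z.2 ^ 2 ∂F.prod F := by
        gcongr with q
        exact hsq q
    _ = _ := by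
        rw [Finset.sum_const, Finset.card_univ, Fintype.card_prod, nsmul_eq_mul]
        push_cast
        ring

end UStatistic

section UCentering

variable {ι : Type*} [Fintype ι] [DecidableEq ι]

/-- The U-centering of a matrix of pairwise distances (Székely and Rizzo): the modified double
centering whose rows sum to zero off the diagonal. The diagonal is set to zero. -/
noncomputable def uCenter (D : ι → ι → ℝ) (k l : ι) : ℝ :=
  if k = l then 0 else
    D k l - 1 / ((Fintype.card ι : ℝ) - 2) * ∑ i, D i l
      - 1 / ((Fintype.card ι : ℝ) - 2) * ∑ j, D k j
      + 1 / (((Fintype.card ι : ℝ) - 1) * ((Fintype.card ι : ℝ) - 2)) * ∑ i, ∑ j, D i j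

/-- The bias-corrected squared distance variance of a matrix of pairwise distances. -/
noncomputable def uVariance (D : ι → ι → ℝ) : ℝ :=
  1 / ((Fintype.card ι : ℝ) * ((Fintype.card ι : ℝ) - 3)) * ∑ k, ∑ l, uCenter D k l ^ 2

theorem distVarHat_eq_uVariance {n p : ℕ} (x : Fin n → Eucl p) :
    distVarHat x = uVariance fun i j ↦ ‖x i - x j‖ := by
  rw [distVarHat, uVariance, Fintype.card_fin, Finset.sum_filter, Fintype.sum_prod_type]
  congr 1
  refine Finset.sum_congr rfl fun k _ ↦ Finset.sum_congr rfl fun l _ ↦ ?_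
  by_cases hkl : k = l
  · simp [uCenter, hkl]
  · simp [uCenter, sampleCenteredDist, hkl]

theorem uCenter_add (D D' : ι → ι → ℝ) : uCenter (D + D') = uCenter D + uCenter D' := by
  ext k l
  by_cases hkl : k = l
  · simp [uCenter, hkl]
  · simp only [uCenter, hkl, if_false, Pi.add_apply, Finset.sum_add_distrib]
    ring

theorem uCenter_additive (hι : 2 < Fintype.card ι) (α : ι → ℝ) (γ : ℝ) :
    uCenter (fun k l ↦ if k = l then 0 else α k + α l - γ) = 0 := by
  have hN : (2 : ℝ) < Fintype.card ι := by exact_mod_cast hι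
  have hN1 : (Fintype.card ι : ℝ) - 1 ≠ 0 := by linarith
  have hN2 : (Fintype.card ι : ℝ) - 2 ≠ 0 := by linarith
  have hrow (k : ι) : ∑ l, (if k = l then 0 else α k + α l - γ) =
      (Fintype.card ι - 2) * α k + ∑ l, α l - (Fintype.card ι - 1) * γ := by
    rw [← Finset.add_sum_erase _ _ (Finset.mem_univ k), if_pos rfl, zero_add,
      Finset.sum_congr rfl fun l hl ↦ if_neg (Finset.ne_of_mem_erase hl).symm,
      Finset.sum_sub_distrib, Finset.sum_add_distrib, Finset.sum_erase_eq_sub (Finset.mem_univ k)]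
    simp [Finset.card_erase_of_mem, Nat.cast_sub (show 1 ≤ Fintype.card ι by omega)]
    ring
  have hcol (l : ι) : ∑ k, (if k = l then 0 else α k + α l - γ) =
      (Fintype.card ι - 2) * α l + ∑ k, α k - (Fintype.card ι - 1) * γ := by
    rw [← hrow l]
    exact Finset.sum_congr rfl fun k _ ↦ by simp only [eq_comm, add_comm]
  ext k l
  by_cases hkl : k = l
  · simp [uCenter, hkl]
  simp only [uCenter, hkl, if_false, hrow, hcol, Finset.sum_add_distrib, Finset.sum_sub_distrib,
    ← Finset.mul_sum, Finset.sum_const, Finset.card_univ, nsmul_eq_mul, Pi.zero_apply]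
  field_simp
  ring

variable {b : ι → ι → ℝ} (hsymm : ∀ i j, b i j = b j i) (hdiag : ∀ i, b i i = 0)

include hsymm in
theorem uCenter_of_ne {k l : ι} (hkl : k ≠ l) :
    uCenter b k l = b k l - 1 / ((Fintype.card ι : ℝ) - 2) * (∑ j, b k j + ∑ j, b l j) +
      1 / (((Fintype.card ι : ℝ) - 1) * ((Fintype.card ι : ℝ) - 2)) * ∑ i, ∑ j, b i j := by
  rw [uCenter, if_neg hkl, Finset.sum_congr rfl fun i _ ↦ hsymm i l]
  ring

include hsymm in
theorem uCenter_comm (k l : ι) : uCenter b k l = uCenter b l k := by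
  obtain rfl | hkl := eq_or_ne k l
  · rfl
  · rw [uCenter_of_ne hsymm hkl, uCenter_of_ne hsymm hkl.symm, hsymm, add_comm (∑ j, b k j)]

include hsymm hdiag

theorem sum_uCenter (hι : 2 < Fintype.card ι) (k : ι) : ∑ l, uCenter b k l = 0 := by
  have hN : (2 : ℝ) < Fintype.card ι := by exact_mod_cast hι
  have hN1 : (Fintype.card ι : ℝ) - 1 ≠ 0 := by linarith
  have hN2 : (Fintype.card ι : ℝ) - 2 ≠ 0 := by linarith
  rw [← Finset.add_sum_erase _ _ (Finset.mem_univ k), show uCenter b k k = 0 from if_pos rfl,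
    zero_add, Finset.sum_congr rfl fun l hl ↦
      uCenter_of_ne hsymm (Finset.ne_of_mem_erase hl).symm]
  simp only [Finset.sum_add_distrib, Finset.sum_sub_distrib, ← Finset.mul_sum,
    Finset.sum_erase_eq_sub (Finset.mem_univ k), hdiag, Finset.sum_const, nsmul_eq_mul,
    Finset.card_univ]
  field_simp
  ring

-- The rows and columns of the centered matrix sum to zero, so it is orthogonal to the corrections
-- subtracted from `b`.
theorem sum_uCenter_sq_eq_sum_mul (hι : 2 < Fintype.card ι) :
    ∑ k, ∑ l, uCenter b k l ^ 2 = ∑ k, ∑ l, uCenter b k l * b k l := by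
  set u := 1 / ((Fintype.card ι : ℝ) - 2)
  set v := 1 / (((Fintype.card ι : ℝ) - 1) * ((Fintype.card ι : ℝ) - 2)) * ∑ i, ∑ j, b i j
  have hterm (k l : ι) : uCenter b k l ^ 2 = uCenter b k l * b k l -
      u * (uCenter b l k * ∑ j, b l j) - u * (∑ j, b k j) * uCenter b k l +
        v * uCenter b k l := by
    obtain rfl | hkl := eq_or_ne k l
    · simp [uCenter]
    · rw [uCenter_comm hsymm l k, sq]
      nth_rw 2 [uCenter_of_ne hsymm hkl]
      ring
  simp only [hterm, Finset.sum_add_distrib, Finset.sum_sub_distrib, ← Finset.mul_sum,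
    sum_uCenter hsymm hdiag hι]
  rw [Finset.sum_comm (f := fun k l ↦ uCenter b l k * ∑ j, b l j)]
  simp only [← Finset.sum_mul, sum_uCenter hsymm hdiag hι]
  simp

theorem sum_uCenter_sq (hι : 2 < Fintype.card ι) :
    ∑ k, ∑ l, uCenter b k l ^ 2 =
      ∑ k, ∑ l, b k l ^ 2 - 2 / ((Fintype.card ι : ℝ) - 2) * ∑ k, (∑ l, b k l) ^ 2 +
        1 / (((Fintype.card ι : ℝ) - 1) * ((Fintype.card ι : ℝ) - 2)) *
          (∑ k, ∑ l, b k l) ^ 2 := by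
  set u := 1 / ((Fintype.card ι : ℝ) - 2) with hu
  set v := 1 / (((Fintype.card ι : ℝ) - 1) * ((Fintype.card ι : ℝ) - 2))
  have hterm (k l : ι) : uCenter b k l * b k l = b k l ^ 2 - u * ((∑ j, b l j) * b l k) -
      u * ((∑ j, b k j) * b k l) + v * (∑ i, ∑ j, b i j) * b k l := by
    obtain rfl | hkl := eq_or_ne k l
    · simp [hdiag]
    · rw [uCenter_of_ne hsymm hkl, hsymm l k]
      ring
  rw [sum_uCenter_sq_eq_sum_mul hsymm hdiag hι]
  simp only [hterm, Finset.sum_add_distrib, Finset.sum_sub_distrib, ← Finset.mul_sum]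
  rw [Finset.sum_comm (f := fun k l ↦ (∑ j, b l j) * b l k)]
  simp only [← Finset.mul_sum, sq]
  rw [hu]
  ring

end UCentering

theorem sqrt_four_mul_cube_mul_div_le {N m τ : ℝ} (hN : 6 ≤ N) (hm : 0 ≤ m) (hτ : 0 < τ) :
    √(4 * N ^ 3 * m) / (N * (N - 3) * τ) ≤ 4 * √(m / (N * τ ^ 2)) := by
  have hN3 : 0 < N - 3 := by linarith
  have hle : 4 * N ^ 3 * m ≤ (4 * (N * (N - 3) * τ)) ^ 2 * (m / (N * τ ^ 2)) := by
    have : (4 * (N * (N - 3) * τ)) ^ 2 * (m / (N * τ ^ 2)) = 4 * N * m * (2 * (N - 3)) ^ 2 := by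
      field_simp
      ring
    rw [this, show 4 * N ^ 3 * m = 4 * N * m * N ^ 2 by ring]
    gcongr
    linarith
  rw [div_le_iff₀ (by positivity)]
  refine (Real.sqrt_le_sqrt hle).trans_eq ?_
  rw [Real.sqrt_mul (sq_nonneg _), Real.sqrt_sq (by positivity)]
  ring

theorem uCentering_remainder_le {N τ : ℝ} (hN : 6 ≤ N) (hτ : 0 < τ) :
    2 / (N - 3) + 2 / ((N - 2) * (N * (N - 3) * τ)) * (2 * (N ^ 2 * τ)) +
      4 / ((N - 1) * (N - 2) * (N * (N - 3) * τ)) * (N ^ 2 / 2 * τ) ≤ 18 / N := by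
  have hN1 : 0 < N - 1 := by linarith
  have hN2 : 0 < N - 2 := by linarith
  have hN3 : 0 < N - 3 := by linarith
  have h₁ : 2 / (N - 3) ≤ 4 / N := by
    rw [div_le_div_iff₀ hN3 (by linarith)]
    linarith
  have h₂ : 2 / ((N - 2) * (N * (N - 3) * τ)) * (2 * (N ^ 2 * τ)) ≤ 12 / N := by
    rw [show 2 / ((N - 2) * (N * (N - 3) * τ)) * (2 * (N ^ 2 * τ)) =
      4 * N / ((N - 2) * (N - 3)) by field_simp; ring, div_le_div_iff₀ (by positivity)
      (by linarith)]
    nlinarith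
  have h₃ : 4 / ((N - 1) * (N - 2) * (N * (N - 3) * τ)) * (N ^ 2 / 2 * τ) ≤ 2 / N := by
    rw [show 4 / ((N - 1) * (N - 2) * (N * (N - 3) * τ)) * (N ^ 2 / 2 * τ) =
      2 * N / ((N - 1) * (N - 2) * (N - 3)) by field_simp; ring, div_le_div_iff₀ (by positivity)
      (by linarith)]
    nlinarith [mul_nonneg (mul_pos hN1 hN2).le (sub_nonneg.2 hN)]
  have : 4 / N + 12 / N + 2 / N = 18 / N := by ring
  linarith

section RatioConsistency

/-- The weights that are all one off the diagonal, so that sums over pairs of distinct indices are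
`quadForm`s and `linearPart`s. -/
def offDiagWeight {ι : Type*} [DecidableEq ι] (i j : ι) : ℝ := if i = j then 0 else 1

theorem norm_sub_eq_doubleCenteredDist {n p : ℕ} (F : Measure (Eucl p)) (x : Fin n → Eucl p)
    (i j : Fin n) :
    ‖x i - x j‖ = offDiagWeight i j * doubleCenteredDist F (x i) (x j) +
      if i = j then 0 else (∫ z, ‖x i - z‖ ∂F) + (∫ z, ‖x j - z‖ ∂F) -
        ∫ z, ‖z.1 - z.2‖ ∂F.prod F := by
  by_cases hij : i = j
  · simp [offDiagWeight, hij]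
  · simp [offDiagWeight, hij, doubleCenteredDist_eq]

theorem distVarHat_eq_uVariance_doubleCenteredDist {n p : ℕ} (hn : 2 < n) (F : Measure (Eucl p))
    (x : Fin n → Eucl p) :
    distVarHat x =
      uVariance fun i j ↦ offDiagWeight i j * doubleCenteredDist F (x i) (x j) := by
  rw [distVarHat_eq_uVariance, uVariance, show (fun i j ↦ ‖x i - x j‖) = _ + _ from
      funext₂ (norm_sub_eq_doubleCenteredDist F x), uCenter_add,
    uCenter_additive (by rwa [Fintype.card_fin]), add_zero, uVariance]

variable {ι E : Type*} [DecidableEq ι]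

theorem offDiagWeight_self (i : ι) : offDiagWeight i i = 0 := if_pos rfl

theorem offDiagWeight_comm (i j : ι) : offDiagWeight i j = offDiagWeight j i := by
  simp only [offDiagWeight, eq_comm]

variable [Fintype ι]

theorem sum_offDiagWeight_sq_le :
    ∑ i : ι, ∑ j, offDiagWeight i j ^ 2 ≤ (Fintype.card ι : ℝ) ^ 2 :=
  calc _ ≤ ∑ _i : ι, ∑ _j : ι, (1 : ℝ) := by
        gcongr with i _ j
        unfold offDiagWeight
        split_ifs <;> norm_num
    _ = _ := by simp [sq]

theorem uVariance_div_sub_one_eq {h : E → E → ℝ} (hsymm : ∀ x y, h x y = h y x)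
    (hι : 3 < Fintype.card ι) {τ : ℝ} (hτ : τ ≠ 0) (x : ι → E) :
    uVariance (fun i j ↦ offDiagWeight i j * h (x i) (x j)) / τ - 1 =
      (∑ i, ∑ j, if i = j then 0 else h (x i) (x j) ^ 2 - τ) /
          (Fintype.card ι * (Fintype.card ι - 3) * τ) +
        2 / ((Fintype.card ι : ℝ) - 3) -
        2 / ((Fintype.card ι - 2) * (Fintype.card ι * (Fintype.card ι - 3) * τ)) *
          ∑ i, linearPart offDiagWeight h i x ^ 2 +
        4 / ((Fintype.card ι - 1) * (Fintype.card ι - 2) *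
          (Fintype.card ι * (Fintype.card ι - 3) * τ)) * quadForm offDiagWeight h x ^ 2 := by
  have hN : (3 : ℝ) < Fintype.card ι := by exact_mod_cast hι
  have hN0 : (Fintype.card ι : ℝ) ≠ 0 := by linarith
  have hN1 : (Fintype.card ι : ℝ) - 1 ≠ 0 := by linarith
  have hN2 : (Fintype.card ι : ℝ) - 2 ≠ 0 := by linarith
  have hN3 : (Fintype.card ι : ℝ) - 3 ≠ 0 := by linarith
  have hterm (i j : ι) : (offDiagWeight i j * h (x i) (x j)) ^ 2 =
      (if i = j then 0 else h (x i) (x j) ^ 2 - τ) + τ - if i = j then τ else 0 := by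
    by_cases hij : i = j <;> simp [offDiagWeight, hij]
  have hsq : ∑ i, ∑ j, (offDiagWeight i j * h (x i) (x j)) ^ 2 =
      (∑ i, ∑ j, if i = j then 0 else h (x i) (x j) ^ 2 - τ) +
        Fintype.card ι * (Fintype.card ι - 1) * τ := by
    simp only [hterm, Finset.sum_sub_distrib, Finset.sum_add_distrib, Finset.sum_const,
      Finset.card_univ, nsmul_eq_mul, Finset.sum_ite_eq, Finset.mem_univ, if_true]
    ring
  rw [uVariance, sum_uCenter_sq (fun i j ↦ by rw [offDiagWeight_comm, hsymm])
    (fun i ↦ by rw [offDiagWeight_self, zero_mul]) (by omega), hsq, quadForm]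
  simp only [linearPart]
  field_simp
  ring

variable [MeasurableSpace E] {F : Measure E} [IsProbabilityMeasure F] {h : E → E → ℝ}
  (hh : IsDegenerateKernel F h)
include hh

theorem memLp_sum_sq_sub (τ : ℝ) :
    MemLp (fun x : ι → E ↦ ∑ i, ∑ j, if i = j then 0 else h (x i) (x j) ^ 2 - τ) 2
      (iidLaw ι F) := by
  refine memLp_finsetSum _ fun i _ ↦ memLp_finsetSum _ fun j _ ↦ ?_
  obtain rfl | hij := eq_or_ne i j
  · simp
  · simp only [hij, if_false, sq]
    exact (memLp_two_mul (memLp_pair hh.memLp hij) (memLp_pair hh.memLp hij)).sub (memLp_const τ)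

theorem integral_abs_sum_sq_sub_le :
    ∫ x, |∑ i, ∑ j, if i = j then 0 else
        h (x i) (x j) ^ 2 - ∫ z, h z.1 z.2 ^ 2 ∂F.prod F| ∂iidLaw ι F ≤
      √(4 * (Fintype.card ι : ℝ) ^ 3 * ∫ z, h z.1 z.2 ^ 4 ∂F.prod F) := by
  set τ := ∫ z, h z.1 z.2 ^ 2 ∂F.prod F
  have hsq : MemLp (fun z : E × E ↦ h z.1 z.2 ^ 2) 2 (F.prod F) := by
    simp_rw [sq]
    exact memLp_two_mul hh.memLp hh.memLp
  have hvar : ∫ z, (h z.1 z.2 ^ 2 - τ) ^ 2 ∂F.prod F ≤ ∫ z, h z.1 z.2 ^ 4 ∂F.prod F :=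
    calc _ = Var[fun z : E × E ↦ h z.1 z.2 ^ 2; F.prod F] :=
          (variance_eq_integral hsq.aestronglyMeasurable.aemeasurable).symm
      _ ≤ ∫ z, (h z.1 z.2 ^ 2) ^ 2 ∂F.prod F := variance_le_expectation_sq hsq.aestronglyMeasurable
      _ = _ := by simp_rw [← pow_mul]
  have hcent : ∫ z, h z.1 z.2 ^ 2 - τ ∂F.prod F = 0 := by
    rw [integral_sub (hsq.integrable one_le_two) (integrable_const _), integral_const,
      probReal_univ, one_smul, sub_self]
  refine (integral_abs_le_sqrt (memLp_sum_sq_sub hh τ)).trans (Real.sqrt_le_sqrt ?_)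
  have hk : MemLp (Function.uncurry fun x y ↦ h x y ^ 2 - τ) 2 (F.prod F) :=
    hsq.sub (memLp_const τ)
  refine (integral_sq_sum_pair_le_of_centered hk hcent).trans ?_
  gcongr

theorem integral_sum_linearPart_offDiagWeight_sq_le :
    ∫ x, ∑ i, linearPart offDiagWeight h i x ^ 2 ∂iidLaw ι F ≤
      2 * ((Fintype.card ι : ℝ) ^ 2 * ∫ z, h z.1 z.2 ^ 2 ∂F.prod F) := by
  rw [integral_finsetSum _ fun i _ ↦
    (memLp_two_of_four (memLp_linearPart offDiagWeight_self hh i)).integrable_sq]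
  calc _ ≤ ∑ i : ι, 2 * ((∑ j, offDiagWeight i j ^ 2) * ∫ z, h z.1 z.2 ^ 2 ∂F.prod F) :=
        Finset.sum_le_sum fun i _ ↦ integral_linearPart_sq_le offDiagWeight_self hh i
    _ ≤ _ := by
        rw [← Finset.mul_sum, ← Finset.sum_mul]
        gcongr
        exact sum_offDiagWeight_sq_le

theorem integral_quadForm_offDiagWeight_sq_le :
    ∫ x, quadForm (offDiagWeight (ι := ι)) h x ^ 2 ∂iidLaw ι F ≤
      (Fintype.card ι : ℝ) ^ 2 / 2 * ∫ z, h z.1 z.2 ^ 2 ∂F.prod F :=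
  (integral_quadForm_sq_le offDiagWeight_self hh).trans (by
    gcongr
    exact sum_offDiagWeight_sq_le)

theorem integrable_sum_linearPart_offDiagWeight_sq :
    Integrable (fun x ↦ ∑ i, linearPart (offDiagWeight (ι := ι)) h i x ^ 2) (iidLaw ι F) :=
  integrable_finsetSum _ fun i _ ↦
    (memLp_two_of_four (memLp_linearPart offDiagWeight_self hh i)).integrable_sq

theorem integrable_quadForm_offDiagWeight_sq :
    Integrable (fun x ↦ quadForm (offDiagWeight (ι := ι)) h x ^ 2) (iidLaw ι F) :=
  (memLp_two_of_four (memLp_quadForm offDiagWeight_self hh)).integrable_sq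

theorem integrable_uVariance_div_sub_one (hι : 3 < Fintype.card ι) {τ : ℝ} (hτ : τ ≠ 0) :
    Integrable (fun x ↦ uVariance (fun i j ↦ offDiagWeight i j * h (x i) (x j)) / τ - 1)
      (iidLaw ι F) := by
  simp_rw [uVariance_div_sub_one_eq hh.symm hι hτ]
  exact (((((memLp_sum_sq_sub hh τ).integrable one_le_two).div_const _).add
    (integrable_const _)).sub ((integrable_sum_linearPart_offDiagWeight_sq hh).const_mul _)).add
      ((integrable_quadForm_offDiagWeight_sq hh).const_mul _)

theorem integral_abs_uVariance_div_sub_one_le_add {N τ : ℝ} (hN : N = Fintype.card ι) (hN3 : 3 < N)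
    (hτ : τ = ∫ z, h z.1 z.2 ^ 2 ∂F.prod F) (hpos : 0 < τ) :
    ∫ x, |uVariance (fun i j : ι ↦ offDiagWeight i j * h (x i) (x j)) / τ - 1| ∂iidLaw ι F ≤
      √(4 * N ^ 3 * ∫ z, h z.1 z.2 ^ 4 ∂F.prod F) / (N * (N - 3) * τ) + 2 / (N - 3) +
        2 / ((N - 2) * (N * (N - 3) * τ)) * (2 * (N ^ 2 * τ)) +
        4 / ((N - 1) * (N - 2) * (N * (N - 3) * τ)) * (N ^ 2 / 2 * τ) := by
  have hι : 3 < Fintype.card ι := by exact_mod_cast hN ▸ hN3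
  have hD : 0 < N * (N - 3) * τ := by
    have : 0 < N - 3 := by linarith
    positivity
  have hc₁ : 0 ≤ 2 / ((N - 2) * (N * (N - 3) * τ)) := by
    have : 0 < N - 2 := by linarith
    positivity
  have hc₂ : 0 ≤ 4 / ((N - 1) * (N - 2) * (N * (N - 3) * τ)) := by
    have : 0 < (N - 1) * (N - 2) := mul_pos (by linarith) (by linarith)
    positivity
  have hG := ((memLp_sum_sq_sub (ι := ι) hh τ).integrable one_le_two).div_const (N * (N - 3) * τ)
  have hQ := (integrable_sum_linearPart_offDiagWeight_sq (ι := ι) hh).const_mul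
    (2 / ((N - 2) * (N * (N - 3) * τ)))
  have hS := (integrable_quadForm_offDiagWeight_sq (ι := ι) hh).const_mul
    (4 / ((N - 1) * (N - 2) * (N * (N - 3) * τ)))
  have hG' := hG.add (integrable_const (2 / (N - 3)))
  simp only [uVariance_div_sub_one_eq hh.symm hι hpos.ne', ← hN]
  refine (integral_abs_add_le (hG'.sub hQ) hS).trans (add_le_add
    ((integral_abs_sub_le hG' hQ).trans (add_le_add
      ((integral_abs_add_le hG (integrable_const _)).trans (add_le_add ?_ ?_)) ?_)) ?_)
  · simp_rw [abs_div _ (N * (N - 3) * τ), abs_of_pos hD]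
    subst hN hτ
    rw [integral_div]
    exact div_le_div_of_nonneg_right (integral_abs_sum_sq_sub_le hh) hD.le
  · simp [abs_of_pos, hN3]
  · have hnonneg (x : ι → E) : 0 ≤ ∑ i : ι, linearPart offDiagWeight h i x ^ 2 :=
      Finset.sum_nonneg fun i _ ↦ sq_nonneg _
    simp_rw [abs_mul, abs_of_nonneg hc₁, fun x ↦ abs_of_nonneg (hnonneg x)]
    subst hN hτ
    rw [integral_const_mul]
    exact mul_le_mul_of_nonneg_left (integral_sum_linearPart_offDiagWeight_sq_le hh) hc₁
  · simp_rw [abs_mul, abs_of_nonneg hc₂, abs_sq]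
    subst hN hτ
    rw [integral_const_mul]
    exact mul_le_mul_of_nonneg_left (integral_quadForm_offDiagWeight_sq_le hh) hc₂

theorem integral_abs_uVariance_div_sub_one_le (hι : 6 ≤ Fintype.card ι)
    (hpos : 0 < ∫ z, h z.1 z.2 ^ 2 ∂F.prod F) :
    ∫ x, |uVariance (fun i j ↦ offDiagWeight i j * h (x i) (x j)) /
        (∫ z, h z.1 z.2 ^ 2 ∂F.prod F) - 1| ∂iidLaw ι F ≤
      4 * √((∫ z, h z.1 z.2 ^ 4 ∂F.prod F) /
        (Fintype.card ι * (∫ z, h z.1 z.2 ^ 2 ∂F.prod F) ^ 2)) + 18 / Fintype.card ι := by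
  have hN : 6 ≤ (Fintype.card ι : ℝ) := by exact_mod_cast hι
  refine (integral_abs_uVariance_div_sub_one_le_add hh rfl (by linarith) rfl hpos).trans ?_
  have hm : 0 ≤ ∫ z, h z.1 z.2 ^ 4 ∂F.prod F := integral_nonneg fun _ ↦ by positivity
  generalize ∫ z, h z.1 z.2 ^ 2 ∂F.prod F = τ at hpos ⊢
  generalize ∫ z, h z.1 z.2 ^ 4 ∂F.prod F = m at hm ⊢
  generalize (Fintype.card ι : ℝ) = N at hN ⊢
  have hroot := sqrt_four_mul_cube_mul_div_le hN hm hpos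
  have hrest := uCentering_remainder_le hN hpos
  linarith

end RatioConsistency

section ClassWeights

variable {n K : ℕ} {y : Fin n → Fin K}

/-- The weights `w` for which the sample Gini covariance is `½ ∑ᵢⱼ wᵢⱼ ‖xᵢ - xⱼ‖`. -/
noncomputable def classWeight (y : Fin n → Fin K) (i j : Fin n) : ℝ :=
  if i = j then 0
  else if y i = y j then 2 / ((n : ℝ) * (n - 1)) - 2 / ((n : ℝ) * (classSize y (y i) - 1))
  else 2 / ((n : ℝ) * (n - 1))

/-- The factor of `sigmaHatSq` that depends only on the labels. -/
noncomputable def varFactor (y : Fin n → Fin K) : ℝ :=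
  (∑ k, pHat y k ^ 2 * (((classSize y k).choose 2 : ℕ) : ℝ)⁻¹) - ((n.choose 2 : ℕ) : ℝ)⁻¹

theorem classWeight_self (i : Fin n) : classWeight y i i = 0 := if_pos rfl

theorem classWeight_comm (i j : Fin n) : classWeight y i j = classWeight y j i := by
  by_cases hy : y i = y j
  · simp only [classWeight, eq_comm (a := i), hy]
  · simp only [classWeight, eq_comm (a := i), hy, Ne.symm hy, if_false]

theorem sum_comp_label (y : Fin n → Fin K) (f : Fin K → ℝ) :
    ∑ i, f (y i) = ∑ k, classSize y k * f k := by
  rw [← Finset.sum_fiberwise' Finset.univ y f]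
  simp [classSize, classIndices]

theorem sum_classSize (y : Fin n → Fin K) : ∑ k, (classSize y k : ℝ) = n := by
  simpa using (sum_comp_label y fun _ ↦ 1).symm

theorem classSize_le (y : Fin n → Fin K) (k : Fin K) : classSize y k ≤ n :=
  (Finset.card_le_univ _).trans_eq (Fintype.card_fin n)

theorem sum_ite_label (y : Fin n → Fin K) (i : Fin n) (a b : ℝ) :
    ∑ j, (if i = j then 0 else if y i = y j then a else b) =
      (classSize y (y i) - 1) * a + (n - classSize y (y i)) * b := by
  have hterm (j : Fin n) : (if i = j then 0 else if y i = y j then a else b) =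
      (if y j = y i then a - b else 0) + b - if j = i then a else 0 := by
    obtain rfl | hij := eq_or_ne i j
    · simp
    · simp only [hij, hij.symm, if_false, eq_comm (a := y i)]
      split_ifs <;> ring
  simp only [hterm, Finset.sum_sub_distrib, Finset.sum_add_distrib, Finset.sum_ite_eq',
    Finset.mem_univ, if_true]
  simp only [← Finset.sum_filter, Finset.sum_const, Finset.card_univ, Fintype.card_fin,
    nsmul_eq_mul]
  rw [classSize, classIndices]
  ring

theorem sum_classWeight {i : Fin n} (hi : 2 ≤ classSize y (y i)) : ∑ j, classWeight y i j = 0 := by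
  have hk : (2 : ℝ) ≤ classSize y (y i) := by exact_mod_cast hi
  have hn : (2 : ℝ) ≤ n := by exact_mod_cast hi.trans (classSize_le y _)
  have hk1 : (classSize y (y i) : ℝ) - 1 ≠ 0 := by linarith
  have hn1 : (n : ℝ) - 1 ≠ 0 := by linarith
  have hn0 : (n : ℝ) ≠ 0 := by linarith
  simp only [classWeight, sum_ite_label]
  field_simp
  ring

theorem sum_classWeight_sq_row {i : Fin n} (hi : 2 ≤ classSize y (y i)) :
    ∑ j, classWeight y i j ^ 2 =
      4 / n * (1 / (n * (classSize y (y i) - 1)) - 1 / (n * (n - 1))) := by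
  have hk : (2 : ℝ) ≤ classSize y (y i) := by exact_mod_cast hi
  have hn : (2 : ℝ) ≤ n := by exact_mod_cast hi.trans (classSize_le y _)
  have hk1 : (classSize y (y i) : ℝ) - 1 ≠ 0 := by linarith
  have hn1 : (n : ℝ) - 1 ≠ 0 := by linarith
  have hn0 : (n : ℝ) ≠ 0 := by linarith
  simp only [classWeight, ite_pow, zero_pow two_ne_zero, sum_ite_label]
  field_simp
  ring

theorem varFactor_eq (hy : ∀ k, classSize y k ≠ 0) :
    varFactor y = 2 / n * ((∑ k, (classSize y k : ℝ) / (n * (classSize y k - 1))) -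
      1 / (n - 1)) := by
  have hterm (k : Fin K) : pHat y k ^ 2 * (((classSize y k).choose 2 : ℕ) : ℝ)⁻¹ =
      2 / n * ((classSize y k : ℝ) / (n * (classSize y k - 1))) := by
    have hk : (classSize y k : ℝ) ≠ 0 := by exact_mod_cast hy k
    rw [pHat, Nat.cast_choose_two]
    field_simp
  rw [varFactor, Finset.sum_congr rfl fun k _ ↦ hterm k, ← Finset.mul_sum, Nat.cast_choose_two]
  field_simp

theorem sum_classWeight_sq (hy : ∀ k, 2 ≤ classSize y k) :
    ∑ i, ∑ j, classWeight y i j ^ 2 = 2 * varFactor y := by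
  rw [Finset.sum_congr rfl fun i _ ↦ sum_classWeight_sq_row (hy (y i)), sum_comp_label y fun k ↦
    4 / (n : ℝ) * (1 / (n * (classSize y k - 1)) - 1 / (n * (n - 1))),
    varFactor_eq fun k ↦ (two_pos.trans_le (hy k)).ne']
  have hterm (k : Fin K) : (classSize y k : ℝ) *
      (4 / n * (1 / (n * (classSize y k - 1)) - 1 / (n * (n - 1)))) =
      4 / n * (classSize y k / (n * (classSize y k - 1))) -
        classSize y k * (4 / n * (1 / (n * (n - 1)))) := by ring
  simp only [hterm, Finset.sum_sub_distrib, ← Finset.mul_sum, ← Finset.sum_mul, sum_classSize]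
  obtain rfl | hn := eq_or_ne n 0
  · simp
  · field_simp
    ring

theorem one_div_sq_le_varFactor (hK : 2 ≤ K) (hy : ∀ k, 2 ≤ classSize y k) :
    1 / (n : ℝ) ^ 2 ≤ varFactor y := by
  have hK' : (2 : ℝ) ≤ K := by exact_mod_cast hK
  have hy' (k : Fin K) : (2 : ℝ) ≤ classSize y k := by exact_mod_cast hy k
  have hn : (4 : ℝ) ≤ n :=
    calc (4 : ℝ) ≤ ∑ _k : Fin K, (2 : ℝ) := by simp; linarith
      _ ≤ n := (Finset.sum_le_sum fun k _ ↦ hy' k).trans_eq (sum_classSize y)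
  have hn0 : (0 : ℝ) < n := by linarith
  have hn1 : (0 : ℝ) < n - 1 := by linarith
  have hsum : 2 / (n : ℝ) ≤ ∑ k, (classSize y k : ℝ) / (n * (classSize y k - 1)) :=
    calc 2 / (n : ℝ) ≤ ∑ _k : Fin K, 1 / (n : ℝ) := by
          simp only [Finset.sum_const, Finset.card_univ, Fintype.card_fin, nsmul_eq_mul,
            mul_one_div]
          gcongr
      _ ≤ _ := by
          refine Finset.sum_le_sum fun k _ ↦ ?_
          have : (0 : ℝ) < classSize y k - 1 := by linarith [hy' k]
          rw [div_le_div_iff₀ hn0 (by positivity)]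
          nlinarith
  have htotal : 1 / ((n : ℝ) - 1) ≤ 3 / 2 / n := by
    rw [div_le_div_iff₀ hn1 hn0]
    linarith
  rw [varFactor_eq fun k ↦ (two_pos.trans_le (hy k)).ne']
  calc 1 / (n : ℝ) ^ 2 = 2 / n * (2 / n - 3 / 2 / n) := by ring
    _ ≤ _ := by gcongr

theorem abs_classWeight_le {c : ℝ} (hc : 0 < c) (hcy : ∀ k, c ≤ pHat y k)
    (hy : ∀ k, 2 ≤ classSize y k) (i j : Fin n) :
    |classWeight y i j| ≤ 4 / (c * (n : ℝ) ^ 2) := by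
  have hk : (2 : ℝ) ≤ classSize y (y i) := by exact_mod_cast hy (y i)
  have hkn : (classSize y (y i) : ℝ) ≤ n := by exact_mod_cast classSize_le y (y i)
  have hn0 : (0 : ℝ) < n := by linarith
  have hck : c * n ≤ classSize y (y i) := (le_div_iff₀ hn0).1 (hcy (y i))
  have hbound {m : ℝ} (hm : classSize y (y i) ≤ m) :
      2 / ((n : ℝ) * (m - 1)) ≤ 4 / (c * (n : ℝ) ^ 2) := by
    have : 0 < m - 1 := by linarith
    rw [div_le_div_iff₀ (by positivity) (by positivity)]
    nlinarith [mul_le_mul_of_nonneg_right (show c * n ≤ 2 * (m - 1) by linarith) hn0.le]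
  have hnonneg {m : ℝ} (hm : classSize y (y i) ≤ m) : 0 ≤ 2 / ((n : ℝ) * (m - 1)) := by
    have : 0 < m - 1 := by linarith
    positivity
  unfold classWeight
  split_ifs
  · rw [abs_zero]
    positivity
  · exact abs_sub_le_of_nonneg_of_le (hnonneg hkn) (hbound hkn) (hnonneg le_rfl) (hbound le_rfl)
  · rw [abs_of_nonneg (hnonneg hkn)]
    exact hbound hkn

end ClassWeights

section GiniCovariance

variable {n p K : ℕ}

theorem two_mul_sum_filter_lt {f : Fin n → Fin n → ℝ} (hsymm : ∀ i j, f i j = f j i)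
    (hdiag : ∀ i, f i i = 0) (s : Finset (Fin n)) :
    2 * ∑ q ∈ (s ×ˢ s).filter (fun q ↦ q.1 < q.2), f q.1 q.2 = ∑ i ∈ s, ∑ j ∈ s, f i j := by
  have hsplit (i j : Fin n) :
      f i j = (if i < j then f i j else 0) + if j < i then f j i else 0 := by
    obtain h | rfl | h := lt_trichotomy i j
    · simp [h, h.not_gt]
    · simp [hdiag]
    · simp [h, h.not_gt, hsymm i j]
  rw [Finset.sum_filter, Finset.sum_product,
    Finset.sum_congr rfl fun i _ ↦ Finset.sum_congr rfl fun j _ ↦ hsplit i j]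
  simp only [Finset.sum_add_distrib]
  rw [Finset.sum_comm (f := fun i j ↦ if j < i then f j i else 0)]
  ring

theorem giniMeanDiff_eq_sum (x : Fin n → Eucl p) (s : Finset (Fin n)) :
    giniMeanDiff x s = 1 / ((s.card : ℝ) * (s.card - 1)) * ∑ i ∈ s, ∑ j ∈ s, ‖x i - x j‖ := by
  rw [giniMeanDiff, Nat.cast_choose_two, ← two_mul_sum_filter_lt (fun i j ↦ norm_sub_rev _ _)
    (fun i ↦ by rw [sub_self, norm_zero])]
  field_simp

theorem pHat_mul_deltaHatClass (x : Fin n → Eucl p) (y : Fin n → Fin K) (k : Fin K) :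
    pHat y k * deltaHatClass x y k = ∑ i, if y i = k then
      ∑ j, if y j = k then 1 / ((n : ℝ) * (classSize y k - 1)) * ‖x i - x j‖ else 0 else 0 := by
  simp only [← Finset.sum_filter, ← Finset.mul_sum]
  change _ = 1 / ((n : ℝ) * (classSize y k - 1)) *
    ∑ i ∈ classIndices y k, ∑ j ∈ classIndices y k, ‖x i - x j‖
  rw [deltaHatClass, giniMeanDiff_eq_sum, pHat]
  change _ / _ * (1 / ((classSize y k : ℝ) * (classSize y k - 1)) * _) = _
  obtain hk | hk := eq_or_ne (classSize y k) 0
  · simp [Finset.card_eq_zero.1 hk]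
  · have : (classSize y k : ℝ) ≠ 0 := by exact_mod_cast hk
    field_simp

theorem gCovSample_eq_sum (x : Fin n → Eucl p) (y : Fin n → Fin K) :
    gCovSample x y = (∑ i, ∑ j, classWeight y i j * ‖x i - x j‖) / 2 := by
  have hterm (i j : Fin n) : classWeight y i j * ‖x i - x j‖ / 2 =
      1 / ((n : ℝ) * (n - 1)) * ‖x i - x j‖ -
        if y j = y i then 1 / ((n : ℝ) * (classSize y (y i) - 1)) * ‖x i - x j‖ else 0 := by
    obtain rfl | hij := eq_or_ne i j
    · simp
    · simp only [classWeight, hij, if_false, eq_comm (a := y i)]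
      split_ifs <;> ring
  rw [gCovSample, Finset.sum_congr rfl fun k _ ↦ pHat_mul_deltaHatClass x y k, Finset.sum_comm]
  simp only [Finset.sum_ite_eq, Finset.mem_univ, if_true, Finset.sum_div, hterm,
    Finset.sum_sub_distrib]
  rw [deltaHat, giniMeanDiff_eq_sum]
  simp only [Finset.card_univ, Fintype.card_fin, Finset.mul_sum]

-- The rows of the weights sum to zero, so that they do not see the additive part of the distances.
theorem gCovSample_eq_quadForm (F : Measure (Eucl p)) (x : Fin n → Eucl p) {y : Fin n → Fin K}
    (hy : ∀ k, 2 ≤ classSize y k) :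
    gCovSample x y = quadForm (classWeight y) (doubleCenteredDist F) x := by
  set α : Fin n → ℝ := fun i ↦ ∫ z, ‖x i - z‖ ∂F
  set γ := ∫ z, ‖z.1 - z.2‖ ∂F.prod F
  have hterm (i j : Fin n) : classWeight y i j * ‖x i - x j‖ =
      classWeight y i j * doubleCenteredDist F (x i) (x j) + (α i - γ) * classWeight y i j +
        α j * classWeight y j i := by
    rw [classWeight_comm j i, doubleCenteredDist_eq]
    ring
  rw [gCovSample_eq_sum, quadForm]
  simp only [hterm, Finset.sum_add_distrib, linearPart]
  rw [Finset.sum_comm (f := fun i j ↦ α j * classWeight y j i)]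
  simp only [← Finset.mul_sum, sum_classWeight (hy _), mul_zero, Finset.sum_const_zero, add_zero]

theorem gCovSample_eq_zero_of_deltaHat {x : Fin n → Eucl p} (hn : 2 ≤ n) (hx : deltaHat x = 0)
    (y : Fin n → Fin K) : gCovSample x y = 0 := by
  have hchoose : ((n.choose 2 : ℕ) : ℝ) ≠ 0 := by exact_mod_cast (Nat.choose_pos hn).ne'
  have hsum := (mul_eq_zero.1 hx).resolve_left (by simpa using hchoose)
  rw [Finset.sum_eq_zero_iff_of_nonneg fun _ _ ↦ norm_nonneg _] at hsum
  have hgini (s : Finset (Fin n)) : giniMeanDiff x s = 0 := by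
    rw [giniMeanDiff, Finset.sum_eq_zero, mul_zero]
    exact fun q hq ↦ hsum q (by simpa using (Finset.mem_filter.1 hq).2)
  simp [gCovSample, deltaHat, deltaHatClass, hgini]

theorem rescaledGCor_eq_gCovSample_div_sigmaHat (hn : 2 ≤ n) (x : Fin n → Eucl p)
    (y : Fin n → Fin K) : rescaledGCor x y = gCovSample x y / sigmaHat x y := by
  rw [rescaledGCor, gCorSample]
  obtain hx | hx := eq_or_ne (deltaHat x) 0
  · simp [hx, gCovSample_eq_zero_of_deltaHat hn hx]
  · field_simp

theorem measurable_giniMeanDiff (s : Finset (Fin n)) :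
    Measurable fun x : Fin n → Eucl p ↦ giniMeanDiff x s := by
  unfold giniMeanDiff
  fun_prop

theorem measurable_distVarHat : Measurable fun x : Fin n → Eucl p ↦ distVarHat x := by
  unfold distVarHat sampleCenteredDist
  fun_prop

theorem measurable_rescaledGCor (y : Fin n → Fin K) :
    Measurable fun x : Fin n → Eucl p ↦ rescaledGCor x y := by
  have hΔ : Measurable fun x : Fin n → Eucl p ↦ deltaHat x := measurable_giniMeanDiff _
  have hσ : Measurable fun x : Fin n → Eucl p ↦ sigmaHat x y :=
    (measurable_distVarHat.const_mul _).sqrt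
  have hcov : Measurable fun x : Fin n → Eucl p ↦ gCovSample x y :=
    hΔ.sub (Finset.measurable_sum _ fun k _ ↦ (measurable_giniMeanDiff _).const_mul _)
  exact (hΔ.div hσ).mul (hcov.div hΔ)

end GiniCovariance

section Studentization

theorem abs_one_div_sqrt_sub_one_le {v : ℝ} (hv : 0 < v) : |1 / √v - 1| ≤ |v - 1| / v := by
  have hs : 0 < √v := Real.sqrt_pos.2 hv
  have hsq : √v * √v = v := Real.mul_self_sqrt hv.le
  have heq : 1 / √v - 1 = (1 - v) / (√v + v) := by
    rw [eq_div_iff (by positivity)]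
    field_simp
    linear_combination -hsq
  rw [heq, abs_div, abs_sub_comm, abs_of_pos (by positivity : 0 < √v + v)]
  gcongr
  linarith

theorem norm_circleExp_mul_div_sqrt_sub_le (t S v : ℝ) :
    ‖(Circle.exp (t * (S / √v)) : ℂ) - Circle.exp (t * S)‖ ≤
      2 * |t| * (|S| * √|v - 1|) + 4 * |v - 1| := by
  obtain hv | hv := le_total |v - 1| (1 / 2)
  · have hvpos : 1 / 2 ≤ v := by linarith [abs_le.1 hv]
    have hroot : |v - 1| ≤ √|v - 1| := Real.le_sqrt_of_sq_le (by nlinarith [abs_nonneg (v - 1)])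
    have hratio : |1 / √v - 1| ≤ 2 * √|v - 1| :=
      calc |1 / √v - 1| ≤ |v - 1| / v := abs_one_div_sqrt_sub_one_le (by linarith)
        _ ≤ |v - 1| / (1 / 2) := by gcongr
        _ ≤ 2 * √|v - 1| := by linarith
    calc ‖(Circle.exp (t * (S / √v)) : ℂ) - Circle.exp (t * S)‖
        = ‖(Circle.exp (t * S) : ℂ) * (Circle.exp (t * S * (1 / √v - 1)) - 1)‖ := by
          rw [mul_sub, ← Circle.coe_mul, ← Circle.exp_add]
          ring_nf
      _ ≤ |t * S * (1 / √v - 1)| := by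
          rw [norm_mul, Circle.norm_coe, one_mul]
          exact norm_circleExp_sub_one_le _
      _ ≤ |t * S| * (2 * √|v - 1|) := by rw [abs_mul]; gcongr
      _ = 2 * |t| * (|S| * √|v - 1|) := by
          rw [abs_mul]
          ring
      _ ≤ _ := le_add_of_nonneg_right (by positivity)
  · calc ‖(Circle.exp (t * (S / √v)) : ℂ) - Circle.exp (t * S)‖ ≤ 1 + 1 := by
          simpa only [Circle.norm_coe] using
            norm_sub_le (Circle.exp (t * (S / √v)) : ℂ) (Circle.exp (t * S))
      _ ≤ 4 * |v - 1| := by linarith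
      _ ≤ _ := le_add_of_nonneg_left (by positivity)

theorem norm_charFun_map_div_sqrt_sub_le {Ω : Type*} [MeasurableSpace Ω] {μ : Measure Ω}
    [IsFiniteMeasure μ] {S v : Ω → ℝ} (hS : MemLp S 2 μ) (hv : Integrable (fun x ↦ v x - 1) μ)
    (t : ℝ) :
    ‖charFun (μ.map fun x ↦ S x / √(v x)) t - charFun (μ.map S) t‖ ≤
      2 * |t| * √((∫ x, S x ^ 2 ∂μ) * ∫ x, |v x - 1| ∂μ) + 4 * ∫ x, |v x - 1| ∂μ := by
  have hvm : AEMeasurable v μ := by simpa using hv.aemeasurable.add_const 1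
  have hT : AEMeasurable (fun x ↦ S x / √(v x)) μ := hS.aemeasurable.div hvm.sqrt
  have hsqrt : MemLp (fun x ↦ √|v x - 1|) 2 μ := by
    rw [memLp_two_iff_integrable_sq hv.abs.aemeasurable.sqrt.aestronglyMeasurable]
    simpa only [Real.sq_sqrt (abs_nonneg _)] using hv.abs
  have hexp {f : Ω → ℝ} (hf : AEMeasurable f μ) :
      Integrable (fun x ↦ (Circle.exp (t * f x) : ℂ)) μ := by
    simpa using integrable_circleExp_mul (hf.const_mul t).aestronglyMeasurable
      (integrable_const (1 : ℝ))
  have hprod : Integrable (fun x ↦ 2 * |t| * (|S x| * √|v x - 1|)) μ :=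
    (hS.abs.integrable_mul hsqrt).const_mul _
  have hcs : ∫ x, (|S x| * √|v x - 1|) ∂μ ≤ √((∫ x, S x ^ 2 ∂μ) * ∫ x, |v x - 1| ∂μ) := by
    simpa only [abs_mul, abs_of_nonneg (Real.sqrt_nonneg _), Real.sq_sqrt (abs_nonneg _)]
      using integral_abs_mul_le hS hsqrt
  rw [charFun_map_real hT, charFun_map_real hS.aemeasurable, ← integral_sub (hexp hT)
    (hexp hS.aemeasurable)]
  calc _ ≤ ∫ x, (2 * |t| * (|S x| * √|v x - 1|) + 4 * |v x - 1|) ∂μ :=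
        norm_integral_le_of_norm_le (hprod.add (hv.abs.const_mul 4))
          (ae_of_all _ fun x ↦ norm_circleExp_mul_div_sqrt_sub_le t (S x) (v x))
    _ = 2 * |t| * (∫ x, (|S x| * √|v x - 1|) ∂μ) + 4 * ∫ x, |v x - 1| ∂μ := by
        rw [integral_add hprod (hv.abs.const_mul 4), integral_const_mul, integral_const_mul]
    _ ≤ _ := by gcongr

end Studentization

section QuantitativeCLT

variable {n p K : ℕ} {F : Measure (Eucl p)} {y : Fin n → Fin K}

theorem quadForm_div {ι E : Type*} [Fintype ι] (a : ι → ι → ℝ) (h : E → E → ℝ) (s : ℝ) :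
    quadForm (fun i j ↦ a i j / s) h = fun x ↦ quadForm a h x / s := by
  ext x
  simp only [quadForm, linearPart, div_mul_eq_mul_div, ← Finset.sum_div]
  ring

/-- The class weights, rescaled so that the quadratic form in the double centered distances has
variance one. -/
noncomputable def standardWeight (F : Measure (Eucl p)) (y : Fin n → Fin K) (i j : Fin n) : ℝ :=
  classWeight y i j / √(varFactor y * centeredMoment F 2)

theorem standardWeight_self (i : Fin n) : standardWeight F y i i = 0 := by
  rw [standardWeight, classWeight_self, zero_div]

theorem standardWeight_comm (i j : Fin n) : standardWeight F y i j = standardWeight F y j i := by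
  rw [standardWeight, classWeight_comm, standardWeight]

theorem rescaledGCor_eq_quadForm_div_sqrt (hK : 2 ≤ K) (hpos : 0 < centeredMoment F 2)
    (hy : ∀ k, 2 ≤ classSize y k) (x : Fin n → Eucl p) :
    rescaledGCor x y = quadForm (standardWeight F y) (doubleCenteredDist F) x /
      √(distVarHat x / centeredMoment F 2) := by
  have hn : 2 ≤ n := (hy ⟨0, by omega⟩).trans (classSize_le y _)
  have hvar : 0 ≤ varFactor y := le_trans (by positivity) (one_div_sq_le_varFactor hK hy)
  have hsigma : sigmaHat x y =
      √(varFactor y * centeredMoment F 2) * √(distVarHat x / centeredMoment F 2) := by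
    rw [← Real.sqrt_mul (mul_nonneg hvar hpos.le), mul_assoc, mul_div_cancel₀ _ hpos.ne']
    rfl
  rw [rescaledGCor_eq_gCovSample_div_sigmaHat hn, hsigma, gCovSample_eq_quadForm F x hy, ← div_div]
  exact congrArg (· / _) (congrFun (quadForm_div _ _ _) x).symm

theorem sum_standardWeight_sq (hK : 2 ≤ K) (hpos : 0 < centeredMoment F 2)
    (hy : ∀ k, 2 ≤ classSize y k) :
    (∑ i, ∑ j, standardWeight F y i j ^ 2) * centeredMoment F 2 = 2 := by
  have hn : 0 < n := by linarith [(hy ⟨0, by omega⟩).trans (classSize_le y _)]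
  have hvar : 0 < varFactor y := lt_of_lt_of_le (by positivity) (one_div_sq_le_varFactor hK hy)
  simp only [standardWeight, div_pow, Real.sq_sqrt (mul_pos hvar hpos).le, ← Finset.sum_div,
    sum_classWeight_sq hy]
  field_simp

theorem abs_standardWeight_le (hK : 2 ≤ K) (hpos : 0 < centeredMoment F 2) {c : ℝ} (hc : 0 < c)
    (hcy : ∀ k, c ≤ pHat y k) (hy : ∀ k, 2 ≤ classSize y k) (i j : Fin n) :
    |standardWeight F y i j| ≤ 4 / (c * n * √(centeredMoment F 2)) := by
  have hn : 0 < n := i.pos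
  have hvar : 1 / (n : ℝ) ≤ √(varFactor y) :=
    Real.le_sqrt_of_sq_le (by simpa using one_div_sq_le_varFactor hK hy)
  rw [standardWeight, abs_div, abs_of_nonneg (Real.sqrt_nonneg _),
    Real.sqrt_mul' _ hpos.le]
  calc _ ≤ 4 / (c * (n : ℝ) ^ 2) / (1 / n * √(centeredMoment F 2)) := by
        gcongr
        exact abs_classWeight_le hc hcy hy i j
    _ = _ := by field_simp

theorem two_le_classSize {c : ℝ} (hn : 2 ≤ c * n) {k : Fin K} (hcy : c ≤ pHat y k) :
    2 ≤ classSize y k := by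
  obtain rfl | hn0 := n.eq_zero_or_pos
  · norm_num at hn
  · rw [pHat, le_div_iff₀ (by exact_mod_cast hn0)] at hcy
    exact_mod_cast hn.trans hcy

/-- The bound for the distance at `t` of the characteristic function of the rescaled Gini
correlation to the standard normal one, when all class proportions are at least `c`. The arguments
`q` and `r` are the ratios of (C2) and (C3), and `s` is the inverse of the sample size. -/
noncomputable def cltError (c t q r s : ℝ) : ℝ :=
  2 * |t| * √(4 * √q + 18 * s) + 4 * (4 * √q + 18 * s) +
    |t| * (12 * t ^ 2 * √(256 / c ^ 4 * q) + |t| * √(256 / c ^ 4 * q + 256 / c ^ 4 * r))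

theorem cltError_nonneg (c t q r : ℝ) {s : ℝ} (hs : 0 ≤ s) : 0 ≤ cltError c t q r s := by
  unfold cltError
  positivity

theorem tendsto_cltError (c t : ℝ) {q r s : ℕ → ℝ} (hq : Tendsto q atTop (𝓝 0))
    (hr : Tendsto r atTop (𝓝 0)) (hs : Tendsto s atTop (𝓝 0)) :
    Tendsto (fun m ↦ cltError c t (q m) (r m) (s m)) atTop (𝓝 0) := by
  have hcont : Continuous fun z : ℝ × ℝ × ℝ ↦ cltError c t z.1 z.2.1 z.2.2 := by
    unfold cltError
    fun_prop
  have hzero : cltError c t 0 0 0 = 0 := by simp [cltError]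
  have hlim := (hcont.tendsto (0, 0, 0)).comp (hq.prodMk_nhds (hr.prodMk_nhds hs))
  rwa [hzero] at hlim

variable [IsProbabilityMeasure F]

theorem norm_charFun_quadForm_standardWeight_sub_le (hK : 2 ≤ K)
    (hF : Integrable (fun x ↦ ‖x‖ ^ 4) F) (hpos : 0 < centeredMoment F 2) {c : ℝ} (hc : 0 < c)
    (hcy : ∀ k, c ≤ pHat y k) (hy : ∀ k, 2 ≤ classSize y k) (t : ℝ) :
    ‖charFun ((iidLaw (Fin n) F).map (quadForm (standardWeight F y) (doubleCenteredDist F))) t -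
        charFun (gaussianReal 0 1) t‖ ≤
      |t| * (12 * t ^ 2 *
          √(256 / c ^ 4 * (centeredMoment F 4 / (n * centeredMoment F 2 ^ 2))) +
        |t| * √(256 / c ^ 4 * (centeredMoment F 4 / (n * centeredMoment F 2 ^ 2)) +
          256 / c ^ 4 * (cyclicMoment F / centeredMoment F 2 ^ 2))) := by
  have hn : (n : ℝ) ≠ 0 := by
    have := (hy ⟨0, by omega⟩).trans (classSize_le y _)
    positivity
  have hh := isDegenerateKernel_doubleCenteredDist hF
  have hτ : √(centeredMoment F 2) ^ 4 = centeredMoment F 2 ^ 2 := by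
    rw [show 4 = 2 * 2 from rfl, pow_mul, Real.sq_sqrt hpos.le]
  have hfourth : (n : ℝ) ^ 3 * (4 / (c * n * √(centeredMoment F 2))) ^ 4 * centeredMoment F 4 =
      256 / c ^ 4 * (centeredMoment F 4 / (n * centeredMoment F 2 ^ 2)) := by
    rw [div_pow, mul_pow, mul_pow, hτ]
    field_simp
    ring
  have hcyclic : (n : ℝ) ^ 4 * (4 / (c * n * √(centeredMoment F 2))) ^ 4 * cyclicMoment F =
      256 / c ^ 4 * (cyclicMoment F / centeredMoment F 2 ^ 2) := by
    rw [div_pow, mul_pow, mul_pow, hτ]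
    field_simp
    ring
  have hle := norm_charFun_quadForm_sub_charFun_gaussianReal_le standardWeight_self
    standardWeight_comm hh
    (abs_standardWeight_le hK hpos hc hcy hy) (sum_standardWeight_sq hK hpos hy) t
  rw [hh.integral_gram_sq, Fintype.card_fin] at hle
  rw [← hfourth, ← hcyclic]
  exact hle

theorem norm_charFun_rescaledGCor_sub_quadForm_le (hK : 2 ≤ K)
    (hF : Integrable (fun x ↦ ‖x‖ ^ 4) F) (hpos : 0 < centeredMoment F 2) (hn : 6 ≤ n)
    (hy : ∀ k, 2 ≤ classSize y k) (t : ℝ) :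
    ‖charFun ((iidLaw (Fin n) F).map fun x ↦ rescaledGCor x y) t -
        charFun ((iidLaw (Fin n) F).map
          (quadForm (standardWeight F y) (doubleCenteredDist F))) t‖ ≤
      2 * |t| * √(4 * √(centeredMoment F 4 / (n * centeredMoment F 2 ^ 2)) + 18 / n) +
        4 * (4 * √(centeredMoment F 4 / (n * centeredMoment F 2 ^ 2)) + 18 / n) := by
  have hh := isDegenerateKernel_doubleCenteredDist hF
  have hvar : ∫ x, quadForm (standardWeight F y) (doubleCenteredDist F) x ^ 2 ∂iidLaw (Fin n) F ≤
      1 := by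
    refine (integral_quadForm_sq_le standardWeight_self hh).trans_eq ?_
    rw [div_mul_eq_mul_div]
    exact (div_eq_one_iff_eq two_ne_zero).2 (sum_standardWeight_sq hK hpos hy)
  have hdist (x : Fin n → Eucl p) := distVarHat_eq_uVariance_doubleCenteredDist (by omega) F x
  have hratio : ∫ x, |distVarHat x / centeredMoment F 2 - 1| ∂iidLaw (Fin n) F ≤
      4 * √(centeredMoment F 4 / (n * centeredMoment F 2 ^ 2)) + 18 / n := by
    have hle := integral_abs_uVariance_div_sub_one_le hh
      (hn.trans_eq (Fintype.card_fin n).symm) hpos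
    rw [Fintype.card_fin] at hle
    simp only [hdist]
    exact hle
  have hint : Integrable (fun x ↦ distVarHat x / centeredMoment F 2 - 1) (iidLaw (Fin n) F) := by
    simpa only [hdist] using
      integrable_uVariance_div_sub_one hh (by rw [Fintype.card_fin]; omega) hpos.ne'
  simp only [rescaledGCor_eq_quadForm_div_sqrt hK hpos hy]
  refine (norm_charFun_map_div_sqrt_sub_le
    (memLp_two_of_four (memLp_quadForm standardWeight_self hh)) hint t).trans ?_
  gcongr
  exact (mul_le_of_le_one_left (integral_nonneg fun _ ↦ abs_nonneg _) hvar).trans hratio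

theorem norm_charFun_rescaledGCor_sub_charFun_gaussianReal_le (hK : 2 ≤ K)
    (hF : Integrable (fun x ↦ ‖x‖ ^ 4) F) (hpos : 0 < centeredMoment F 2) {c : ℝ} (hc : 0 < c)
    (hn : 6 ≤ n) (hcn : 2 ≤ c * n) (hcy : ∀ k, c ≤ pHat y k) (t : ℝ) :
    ‖charFun ((iidLaw (Fin n) F).map fun x ↦ rescaledGCor x y) t -
        charFun (gaussianReal 0 1) t‖ ≤
      cltError c t (centeredMoment F 4 / (n * centeredMoment F 2 ^ 2))
        (cyclicMoment F / centeredMoment F 2 ^ 2) (1 / n) := by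
  have hy (k : Fin K) : 2 ≤ classSize y k := two_le_classSize hcn (hcy k)
  rw [cltError, mul_one_div]
  exact (norm_sub_le_norm_sub_add_norm_sub _ _ _).trans
    (add_le_add (norm_charFun_rescaledGCor_sub_quadForm_le hK hF hpos hn hy t)
      (norm_charFun_quadForm_standardWeight_sub_le hK hF hpos hc hcy hy t))

end QuantitativeCLT

section ConvergenceInLaw

-- Given `y`, the law of `T (·, y)` is close to `ρ` unless `y ∈ s`, and two characteristic
-- functions never differ by more than `2`.
theorem norm_charFun_map_prod_sub_le {α β : Type*} [MeasurableSpace α] [MeasurableSpace β]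
    {μ : Measure α} [IsProbabilityMeasure μ] {ν : Measure β} [IsProbabilityMeasure ν]
    {ρ : Measure ℝ} [IsProbabilityMeasure ρ] {T : α × β → ℝ} (hT : Measurable T) {s : Set β}
    (hs : MeasurableSet s) {t δ : ℝ} (hδ : 0 ≤ δ)
    (h : ∀ y ∉ s, ‖charFun (μ.map fun x ↦ T (x, y)) t - charFun ρ t‖ ≤ δ) :
    ‖charFun ((μ.prod ν).map T) t - charFun ρ t‖ ≤ δ + 2 * ν.real s := by
  have hTy (y : β) : Measurable fun x ↦ T (x, y) := hT.comp (by fun_prop)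
  have hexp : Integrable (fun z ↦ (Circle.exp (t * T z) : ℂ)) (μ.prod ν) := by
    simpa using integrable_circleExp_mul (hT.const_mul t).aestronglyMeasurable
      (integrable_const (1 : ℝ))
  have hsection (y : β) : ∫ x, (Circle.exp (t * T (x, y)) : ℂ) ∂μ =
      charFun (μ.map fun x ↦ T (x, y)) t := (charFun_map_real (hTy y).aemeasurable t).symm
  have hint : Integrable (fun y ↦ charFun (μ.map fun x ↦ T (x, y)) t) ν := by
    simpa only [hsection] using hexp.integral_prod_right
  have hbound (y : β) : ‖charFun (μ.map fun x ↦ T (x, y)) t - charFun ρ t‖ ≤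
      δ + s.indicator (fun _ ↦ 2) y := by
    by_cases hy : y ∈ s
    · have := Measure.isProbabilityMeasure_map (μ := μ) (hTy y).aemeasurable
      rw [Set.indicator_of_mem hy]
      exact le_add_of_nonneg_of_le hδ ((norm_sub_le _ _).trans (by
        linarith [norm_charFun_le_one (μ := μ.map fun x ↦ T (x, y)) t,
          norm_charFun_le_one (μ := ρ) t]))
    · rw [Set.indicator_of_notMem hy, add_zero]
      exact h y hy
  have hind : Integrable (s.indicator fun _ ↦ (2 : ℝ)) ν := (integrable_const _).indicator hs
  calc ‖charFun ((μ.prod ν).map T) t - charFun ρ t‖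
      = ‖∫ y, (charFun (μ.map fun x ↦ T (x, y)) t - charFun ρ t) ∂ν‖ := by
        rw [charFun_map_real hT.aemeasurable, integral_prod_symm _ hexp,
          integral_sub hint (integrable_const _)]
        simp only [hsection, integral_const, probReal_univ, one_smul]
    _ ≤ ∫ y, (δ + s.indicator (fun _ ↦ 2) y) ∂ν :=
        norm_integral_le_of_norm_le ((integrable_const _).add hind) (ae_of_all _ hbound)
    _ = δ + 2 * ν.real s := by
        rw [integral_add (integrable_const _) hind, integral_indicator_const _ hs]
        simp [mul_comm]

theorem tendstoInDistribution_of_tendsto_charFun {Ω : ℕ → Type*} [∀ m, MeasurableSpace (Ω m)]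
    {P : ∀ m, Measure (Ω m)} [∀ m, IsProbabilityMeasure (P m)] {ρ : Measure ℝ}
    [IsProbabilityMeasure ρ] {T : ∀ m, Ω m → ℝ} (hT : ∀ m, AEMeasurable (T m) (P m))
    (h : ∀ t, Tendsto (fun m ↦ charFun ((P m).map (T m)) t) atTop (𝓝 (charFun ρ t))) :
    TendstoInDistribution T atTop (id : ℝ → ℝ) P ρ where
  forall_aemeasurable := hT
  aemeasurable_limit := aemeasurable_id
  tendsto := ProbabilityMeasure.tendsto_of_tendsto_charFun (by simpa using h)

end ConvergenceInLaw

section LabelProportions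

variable {Ω : Type*} [MeasurableSpace Ω] {P : Measure Ω} [IsProbabilityMeasure P]

theorem measureReal_le_abs_sum_sub_le {ι : Type*} [Fintype ι] {Z : ι → Ω → ℝ}
    (hZ : ∀ i, AEMeasurable (Z i) P) (hbound : ∀ i, ∀ᵐ ω ∂P, Z i ω ∈ Set.Icc (0 : ℝ) 1)
    (hind : Pairwise fun i j ↦ IndepFun (Z i) (Z j) P) {ε : ℝ} (hε : 0 < ε) :
    P.real {ω | ε ≤ |(∑ i, Z i) ω - P[∑ i, Z i]|} ≤ Fintype.card ι / ε ^ 2 := by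
  have hmem (i : ι) : MemLp (Z i) 2 P := memLp_of_bounded (hbound i) (hZ i).aestronglyMeasurable 2
  have hvar : variance (∑ i, Z i) P ≤ Fintype.card ι := by
    rw [IndepFun.variance_sum (fun i _ ↦ hmem i) fun i _ j _ hij ↦ hind hij]
    calc _ ≤ ∑ _i : ι, (1 : ℝ) := Finset.sum_le_sum fun i _ ↦
          (variance_le_sq_of_bounded (hbound i) (hZ i)).trans (by norm_num)
      _ = Fintype.card ι := by simp
  calc _ ≤ variance (∑ i, Z i) P / ε ^ 2 :=
        ENNReal.toReal_le_of_le_ofReal (div_nonneg (variance_nonneg _ _) (sq_nonneg _))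
          (meas_ge_le_variance_div_sq (memLp_finsetSum' _ fun i _ ↦ hmem i) hε)
    _ ≤ _ := by gcongr

variable {n K : ℕ} {Y : Fin n → Ω → Fin K}

theorem measureReal_pHat_lt_le (hY : ∀ i, Measurable (Y i)) (hind : iIndepFun Y P) {k : Fin K}
    {q c : ℝ} (hq : ∀ i, P.real {ω | Y i ω = k} = q) (hc : 0 < c) (hcq : 2 * c ≤ q) (hn : 0 < n) :
    P.real {ω | pHat (fun i ↦ Y i ω) k < c} ≤ 1 / (n * c ^ 2) := by
  have hn0 : (0 : ℝ) < n := by exact_mod_cast hn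
  have hs (i : Fin n) : MeasurableSet {ω | Y i ω = k} := hY i (measurableSet_singleton k)
  let Z (i : Fin n) : Ω → ℝ := {ω | Y i ω = k}.indicator 1
  have hZ (i : Fin n) : Measurable (Z i) := measurable_one.indicator (hs i)
  have hbound (i : Fin n) : ∀ᵐ ω ∂P, Z i ω ∈ Set.Icc (0 : ℝ) 1 := ae_of_all _ fun ω ↦
    ⟨Set.indicator_nonneg (fun _ _ ↦ zero_le_one) ω,
      Set.indicator_le_self' (fun _ _ ↦ zero_le_one) ω⟩
  have hZind : iIndepFun Z P :=
    hind.comp (fun _ ↦ ({k} : Set (Fin K)).indicator 1) fun _ ↦ measurable_of_finite _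
  have hint (i : Fin n) : Integrable (Z i) P := (integrable_const 1).indicator (hs i)
  have hmean : P[∑ i, Z i] = n * q := by
    simp_rw [Finset.sum_apply]
    rw [integral_finsetSum _ fun i _ ↦ hint i]
    simp [Z, integral_indicator_one (hs _), hq]
  have hsub : {ω | pHat (fun i ↦ Y i ω) k < c} ⊆ {ω | n * c ≤ |(∑ i, Z i) ω - P[∑ i, Z i]|} := by
    intro ω hω
    have hsize : (classSize (fun i ↦ Y i ω) k : ℝ) = ∑ i, Z i ω := by
      simp [classSize, classIndices, Z, Set.indicator_apply]
    rw [Set.mem_ofPred_eq, pHat, hsize, div_lt_iff₀ hn0] at hω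
    rw [Set.mem_ofPred_eq, hmean, Finset.sum_apply, abs_sub_comm]
    exact le_abs.2 (.inl (by linarith [mul_le_mul_of_nonneg_left hcq hn0.le]))
  calc P.real {ω | pHat (fun i ↦ Y i ω) k < c} ≤ _ := measureReal_mono hsub
    _ ≤ Fintype.card (Fin n) / (n * c) ^ 2 := measureReal_le_abs_sum_sub_le
        (fun i ↦ (hZ i).aemeasurable) hbound (fun i j ↦ hZind.indepFun) (by positivity)
    _ = 1 / (n * c ^ 2) := by rw [Fintype.card_fin]; field_simp

theorem measureReal_exists_pHat_lt_le (hY : ∀ i, Measurable (Y i)) (hind : iIndepFun Y P)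
    {π : Fin K → ℝ} (hπ : ∀ i k, P.real {ω | Y i ω = k} = π k) {c : ℝ} (hc : 0 < c)
    (hcπ : ∀ k, 2 * c ≤ π k) (hn : 0 < n) :
    P.real {ω | ∃ k, pHat (fun i ↦ Y i ω) k < c} ≤ K * (1 / (n * c ^ 2)) := by
  rw [Set.ofPred_exists]
  calc _ ≤ ∑ k, P.real {ω | pHat (fun i ↦ Y i ω) k < c} := measureReal_iUnion_fintype_le _
    _ ≤ ∑ _k : Fin K, 1 / (n * c ^ 2) :=
        Finset.sum_le_sum fun k _ ↦ measureReal_pHat_lt_le hY hind (hπ · k) hc (hcπ k) hn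
    _ = _ := by simp

end LabelProportions

theorem indepFun_pi_of_iIndepFun_prodMk {Ω α β ι : Type*} [Finite ι] [MeasurableSpace Ω]
    [MeasurableSpace α] [MeasurableSpace β] {P : Measure Ω} [IsProbabilityMeasure P]
    {X : ι → Ω → α} {Y : ι → Ω → β} (hX : ∀ i, AEMeasurable (X i) P)
    (hY : ∀ i, AEMeasurable (Y i) P) (hXY : ∀ i, IndepFun (X i) (Y i) P)
    (hind : iIndepFun (fun i ω ↦ (X i ω, Y i ω)) P) :
    IndepFun (fun ω i ↦ X i ω) (fun ω i ↦ Y i ω) P := by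
  have := Fintype.ofFinite ι
  have (i : ι) : IsProbabilityMeasure (P.map (X i)) := Measure.isProbabilityMeasure_map (hX i)
  have (i : ι) : IsProbabilityMeasure (P.map (Y i)) := Measure.isProbabilityMeasure_map (hY i)
  have hXind : iIndepFun X P := hind.comp (fun _ ↦ Prod.fst) fun _ ↦ measurable_fst
  have hYind : iIndepFun Y P := hind.comp (fun _ ↦ Prod.snd) fun _ ↦ measurable_snd
  have hpair (i : ι) : AEMeasurable (fun ω ↦ (X i ω, Y i ω)) P := (hX i).prodMk (hY i)
  have hlaw (i : ι) : P.map (fun ω ↦ (X i ω, Y i ω)) = (P.map (X i)).prod (P.map (Y i)) :=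
    (indepFun_iff_map_prod_eq_prod_map_map (hX i) (hY i)).1 (hXY i)
  have hjoint := (iIndepFun_iff_map_fun_eq_pi_map hpair).1 hind
  simp_rw [hlaw] at hjoint
  rw [indepFun_iff_map_prod_eq_prod_map_map (aemeasurable_pi_lambda _ hX)
    (aemeasurable_pi_lambda _ hY), (iIndepFun_iff_map_fun_eq_pi_map hX).1 hXind,
    (iIndepFun_iff_map_fun_eq_pi_map hY).1 hYind]
  have hswap := measurePreserving_arrowProdEquivProdArrow α β ι (fun i ↦ P.map (X i))
    fun i ↦ P.map (Y i)
  rw [← hswap.map_eq, ← hjoint, AEMeasurable.map_map_of_aemeasurable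
    hswap.measurable.aemeasurable (aemeasurable_pi_lambda _ hpair)]
  rfl

section GaussianLimit

variable {K : ℕ} {p n : ℕ → ℕ} {F : ∀ m, Measure (Eucl (p m))} [∀ m, IsProbabilityMeasure (F m)]
  {Ω : ℕ → Type*} [∀ m, MeasurableSpace (Ω m)] {P : ∀ m, Measure (Ω m)}
  [∀ m, IsProbabilityMeasure (P m)]

theorem measurable_rescaledGCor_prod {p n K : ℕ} :
    Measurable fun z : (Fin n → Eucl p) × (Fin n → Fin K) ↦ rescaledGCor z.1 z.2 :=
  measurable_from_prod_countable_left measurable_rescaledGCor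

theorem aemeasurable_rescaledGCor {p n : ℕ} {Ω : Type*} [MeasurableSpace Ω] {P : Measure Ω}
    {X : Ω → Fin n → Eucl p} {Y : Ω → Fin n → Fin K} (hX : AEMeasurable X P)
    (hY : AEMeasurable Y P) : AEMeasurable (fun ω ↦ rescaledGCor (X ω) (Y ω)) P := by
  have hXY : AEMeasurable (fun ω ↦ (X ω, Y ω)) P := hX.prodMk hY
  simpa only [Function.comp_def] using measurable_rescaledGCor_prod.comp_aemeasurable hXY

theorem norm_charFun_map_rescaledGCor_sub_le {p n : ℕ} {F : Measure (Eucl p)}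
    [IsProbabilityMeasure F] {Ω : Type*} [MeasurableSpace Ω] {P : Measure Ω}
    [IsProbabilityMeasure P] {X : Ω → Fin n → Eucl p} {Y : Ω → Fin n → Fin K} (hK : 2 ≤ K)
    (hF : Integrable (fun x ↦ ‖x‖ ^ 4) F) (hpos : 0 < centeredMoment F 2) {c : ℝ} (hc : 0 < c)
    (hn : 6 ≤ n) (hcn : 2 ≤ c * n) (hX : HasLaw X (iidLaw (Fin n) F) P) (hY : Measurable Y)
    (hXY : IndepFun X Y P) (t : ℝ) :
    ‖charFun (P.map fun ω ↦ rescaledGCor (X ω) (Y ω)) t - charFun (gaussianReal 0 1) t‖ ≤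
      cltError c t (centeredMoment F 4 / (n * centeredMoment F 2 ^ 2))
        (cyclicMoment F / centeredMoment F 2 ^ 2) (1 / n) +
        2 * P.real {ω | ∃ k, pHat (Y ω) k < c} := by
  have := Measure.isProbabilityMeasure_map (μ := P) hY.aemeasurable
  have hs : MeasurableSet {y : Fin n → Fin K | ∃ k, pHat y k < c} := (Set.toFinite _).measurableSet
  have hlaw : P.map (fun ω ↦ rescaledGCor (X ω) (Y ω)) =
      ((iidLaw (Fin n) F).prod (P.map Y)).map fun z ↦ rescaledGCor z.1 z.2 := by
    rw [← hX.map_eq, ← (indepFun_iff_map_prod_eq_prod_map_map hX.aemeasurable hY.aemeasurable).1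
      hXY, AEMeasurable.map_map_of_aemeasurable measurable_rescaledGCor_prod.aemeasurable
      (hX.aemeasurable.prodMk hY.aemeasurable)]
    rfl
  have hle := norm_charFun_map_prod_sub_le (μ := iidLaw (Fin n) F) (ν := P.map Y)
    (ρ := gaussianReal 0 1) measurable_rescaledGCor_prod hs (t := t)
    (cltError_nonneg _ _ _ _ (by positivity)) fun y hy ↦
      norm_charFun_rescaledGCor_sub_charFun_gaussianReal_le hK hF hpos hc hn hcn
        (fun k ↦ not_lt.1 fun hk ↦ hy ⟨k, hk⟩) t
  rwa [map_measureReal_apply hY hs, ← hlaw] at hle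

theorem tendstoInDistribution_rescaledGCor (hK : 2 ≤ K)
    (hF : ∀ m, Integrable (fun x ↦ ‖x‖ ^ 4) (F m)) (hpos : ∀ m, 0 < centeredMoment (F m) 2)
    (hfourth : Tendsto (fun m ↦ centeredMoment (F m) 4 / (n m * centeredMoment (F m) 2 ^ 2)) atTop
      (𝓝 0))
    (hcyclic : Tendsto (fun m ↦ cyclicMoment (F m) / centeredMoment (F m) 2 ^ 2) atTop (𝓝 0))
    (hn : Tendsto n atTop atTop) {X : ∀ m, Ω m → Fin (n m) → Eucl (p m)}
    {Y : ∀ m, Ω m → Fin (n m) → Fin K} (hX : ∀ m, HasLaw (X m) (iidLaw (Fin (n m)) (F m)) (P m))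
    (hY : ∀ m, Measurable (Y m)) (hXY : ∀ m, IndepFun (X m) (Y m) (P m)) {c : ℝ} (hc : 0 < c)
    (hpHat : Tendsto (fun m ↦ (P m).real {ω | ∃ k, pHat (Y m ω) k < c}) atTop (𝓝 0)) :
    TendstoInDistribution (fun m ω ↦ rescaledGCor (X m ω) (Y m ω)) atTop (id : ℝ → ℝ) P
      (gaussianReal 0 1) := by
  have hncast : Tendsto (fun m ↦ (n m : ℝ)) atTop atTop := tendsto_natCast_atTop_atTop.comp hn
  refine tendstoInDistribution_of_tendsto_charFun
    (fun m ↦ aemeasurable_rescaledGCor (hX m).aemeasurable (hY m).aemeasurable) fun t ↦ ?_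
  have hninv : Tendsto (fun m ↦ 1 / (n m : ℝ)) atTop (𝓝 0) := tendsto_const_nhds.div_atTop hncast
  have herror := (tendsto_cltError c t hfourth hcyclic hninv).add (hpHat.const_mul 2)
  rw [mul_zero, add_zero] at herror
  refine tendsto_iff_norm_sub_tendsto_zero.2 (squeeze_zero' (.of_forall fun _ ↦ norm_nonneg _) ?_
    herror)
  filter_upwards [hn.eventually_ge_atTop 6,
    (hncast.const_mul_atTop hc).eventually_ge_atTop 2] with m hm hcm
  exact norm_charFun_map_rescaledGCor_sub_le hK (hF m) (hpos m) hc hm hcm (hX m) (hY m) (hXY m) t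

theorem tendsto_measureReal_exists_pHat_lt {Y : ∀ m, Fin (n m) → Ω m → Fin K} {π : Fin K → ℝ}
    (hY : ∀ m i, Measurable (Y m i)) (hind : ∀ m, iIndepFun (Y m) (P m))
    (hπ : ∀ m i k, (P m).real {ω | Y m i ω = k} = π k) {c : ℝ} (hc : 0 < c)
    (hcπ : ∀ k, 2 * c ≤ π k) (hn : Tendsto n atTop atTop) :
    Tendsto (fun m ↦ (P m).real {ω | ∃ k, pHat (fun i ↦ Y m i ω) k < c}) atTop (𝓝 0) := by
  have hncast : Tendsto (fun m ↦ (n m : ℝ)) atTop atTop := tendsto_natCast_atTop_atTop.comp hn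
  have hbound := ((tendsto_const_nhds (x := (1 : ℝ))).div_atTop
    (hncast.atTop_mul_const (pow_pos hc 2))).const_mul (K : ℝ)
  rw [mul_zero] at hbound
  refine squeeze_zero' (.of_forall fun _ ↦ measureReal_nonneg) ?_ hbound
  filter_upwards [hn.eventually_gt_atTop 0] with m hm
  exact measureReal_exists_pHat_lt_le (hY m) (hind m) (hπ m) hc hcπ hm

end GaussianLimit

end GiniCor

open GiniCor in
theorem corollary1_general {K : ℕ} (hK : 2 ≤ K) (p n : ℕ → ℕ)
    (F : ∀ m, Measure (Eucl (p m))) [∀ m, IsProbabilityMeasure (F m)]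
    (hC1 : ∀ m, Integrable (fun x ↦ ‖x‖ ^ 4) (F m))
    (hpos : ∀ m, 0 < centeredMoment (F m) 2)
    (hC2 : Tendsto (fun m ↦ centeredMoment (F m) 4 /
      ((n m : ℝ) * centeredMoment (F m) 2 ^ 2)) atTop (𝓝 0))
    (hC3 : Tendsto (fun m ↦ cyclicMoment (F m) /
      centeredMoment (F m) 2 ^ 2) atTop (𝓝 0))
    {Ω : ℕ → Type*} [∀ m, MeasurableSpace (Ω m)]
    (P : ∀ m, Measure (Ω m)) [∀ m, IsProbabilityMeasure (P m)]
    (X : ∀ m, Fin (n m) → Ω m → Eucl (p m))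
    (hX : ∀ m i, HasLaw (X m i) (F m) (P m)) :
    (∀ (π : Fin K → ℝ) (Y : ∀ m, Fin (n m) → Ω m → Fin K),
      (∀ k, 0 < π k) →
      (∀ m i, Measurable (Y m i)) →
      (∀ m i k, (P m).real {ω | Y m i ω = k} = π k) →
      (∀ m i, IndepFun (X m i) (Y m i) (P m)) →
      (∀ m, iIndepFun (fun i ω ↦ (X m i ω, Y m i ω)) (P m)) →
      Tendsto n atTop atTop →
      TendstoInDistribution
        (fun m ω ↦ rescaledGCor (fun i ↦ X m i ω) (fun i ↦ Y m i ω))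
        atTop (id : ℝ → ℝ) P (gaussianReal 0 1)) ∧
    (∀ y : ∀ m, Fin (n m) → Fin K,
      (∀ m, iIndepFun (X m) (P m)) →
      (∀ k, Tendsto (fun m ↦ classSize (y m) k) atTop atTop) →
      (∃ c : ℝ, 0 < c ∧ ∀ k, ∀ᶠ m in atTop, c ≤ pHat (y m) k) →
      TendstoInDistribution
        (fun m ω ↦ rescaledGCor (fun i ↦ X m i ω) (y m))
        atTop (id : ℝ → ℝ) P (gaussianReal 0 1)) := by
  have hsample (m : ℕ) (hind : iIndepFun (X m) (P m)) :
      HasLaw (fun ω i ↦ X m i ω) (iidLaw (Fin (n m)) (F m)) (P m) := hind.hasLaw_pi (hX m)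
  constructor
  · intro π Y hπ0 hY hπ hXY hind hn
    have : Nonempty (Fin K) := ⟨⟨0, by omega⟩⟩
    obtain ⟨k₀, hk₀⟩ := Finite.exists_min π
    exact tendstoInDistribution_rescaledGCor hK hC1 hpos hC2 hC3 hn
      (fun m ↦ hsample m ((hind m).comp (fun _ ↦ Prod.fst) fun _ ↦ measurable_fst))
      (fun m ↦ measurable_pi_lambda _ (hY m))
      (fun m ↦ indepFun_pi_of_iIndepFun_prodMk (fun i ↦ (hX m i).aemeasurable)
        (fun i ↦ (hY m i).aemeasurable) (hXY m) (hind m)) (half_pos (hπ0 k₀))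
      (tendsto_measureReal_exists_pHat_lt hY
        (fun m ↦ (hind m).comp (fun _ ↦ Prod.snd) fun _ ↦ measurable_snd) hπ (half_pos (hπ0 k₀))
        (fun k ↦ by linarith [hk₀ k]) hn)
  · rintro y hind hsize ⟨c, hc, hcy⟩
    let k₀ : Fin K := ⟨0, by omega⟩
    have hn : Tendsto n atTop atTop :=
      tendsto_atTop_mono (fun m ↦ classSize_le (y m) k₀) (hsize k₀)
    have hpHat : ∀ᶠ m in atTop, (P m).real {_ω | ∃ k, pHat (y m) k < c} = 0 := by
      filter_upwards [eventually_all.2 hcy] with m hm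
      simp [fun k ↦ not_lt.2 (hm k)]
    exact tendstoInDistribution_rescaledGCor hK hC1 hpos hC2 hC3 hn (fun m ↦ hsample m (hind m))
      (fun m ↦ measurable_const) (fun m ↦ indepFun_const_right _ _) hc
      (tendsto_const_nhds.congr' (hpHat.mono fun _ ↦ Eq.symm))

theorem corollary1 {K : ℕ} (hK : 2 ≤ K)
    -- dimensions and total sample sizes along the asymptotic sequence
    (p n : ℕ → ℕ) (hp : Tendsto p atTop atTop)
    -- the distribution of the numerical variable and its moment conditions
    (F : ∀ m, Measure (GiniCor.Eucl (p m))) [∀ m, IsProbabilityMeasure (F m)]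
    (hC1 : ∀ m, Integrable (fun x => ‖x‖ ^ 4) (F m))
    (hpos : ∀ m, 0 < GiniCor.centeredMoment (F m) 2)
    (hC2 : Tendsto (fun m => GiniCor.centeredMoment (F m) 4 /
      ((n m : ℝ) * GiniCor.centeredMoment (F m) 2 ^ 2)) atTop (𝓝 0))
    (hC3 : Tendsto (fun m => GiniCor.cyclicMoment (F m) /
      GiniCor.centeredMoment (F m) 2 ^ 2) atTop (𝓝 0))
    -- the numerical observations
    {Ω : ℕ → Type*} [∀ m, MeasurableSpace (Ω m)]
    (P : ∀ m, Measure (Ω m)) [∀ m, IsProbabilityMeasure (P m)]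
    (X : ∀ m, Fin (n m) → Ω m → GiniCor.Eucl (p m))
    (hX : ∀ m i, HasLaw (X m i) (F m) (P m)) :
    -- sampling from the joint distribution of `(X, Y)`, with `X` and `Y` independent
    (∀ (π : Fin K → ℝ) (Y : ∀ m, Fin (n m) → Ω m → Fin K),
      (∀ k, 0 < π k) →
      (∀ m i, Measurable (Y m i)) →
      (∀ m i k, (P m).real {ω | Y m i ω = k} = π k) →
      (∀ m i, IndepFun (X m i) (Y m i) (P m)) →
      (∀ m, iIndepFun (fun i ω => (X m i ω, Y m i ω)) (P m)) →
      Tendsto n atTop atTop →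
      TendstoInDistribution
        (fun m ω => GiniCor.rescaledGCor (fun i => X m i ω) (fun i => Y m i ω))
        atTop (id : ℝ → ℝ) P (gaussianReal 0 1)) ∧
    -- K independent samples of given sizes from the same distribution
    (∀ y : ∀ m, Fin (n m) → Fin K,
      (∀ m, iIndepFun (X m) (P m)) →
      (∀ k, Tendsto (fun m => GiniCor.classSize (y m) k) atTop atTop) →
      (∃ c : ℝ, 0 < c ∧ ∀ k, ∀ᶠ m in atTop, c ≤ GiniCor.pHat (y m) k) →
      TendstoInDistribution
        (fun m ω => GiniCor.rescaledGCor (fun i => X m i ω) (y m))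
        atTop (id : ℝ → ℝ) P (gaussianReal 0 1)) :=
  corollary1_general hK p n F hC1 hpos hC2 hC3 P X hX
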